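/- Let $P$ be a finite set of points in the plane $\mathbb{R}^2$. It is in \emph{general position} if no three of its points are collinear, and in \emph{convex position} if no point of $P$ lies in the convex hull of the others. Sets $K_1,\dots,K_k\subset\mathbb{R}^2$ \emph{cover} $\mathbb{R}^2\setminus P$ if $\bigcup_i K_i=\mathbb{R}^2\setminus P$, and they \emph{encapsulate} $P$ if every $p\in P$ has a neighborhood $N$ with $\left(\bigcup_i K_i\right)\cap N=N\setminus\{p\}$. Let $\mathrm{cov}(P)$ (respectively $\mathrm{cov}_\circ(P)$) be the smallest number of convex sets (respectively pairwise disjoint convex sets) that cover $\mathbb{R}^2\setminus P$, and let $\mathrm{enc}(P)$ (respectively $\mathrm{enc}_\circ(P)$) be the smallest number of convex sets (respectively pairwise disjoint convex sets) that encapsulate $P$. For each of these parameters $f$ and each $n\in\mathbb{N}=\{0,1,2,\dots\}$, let $f(n)$ be the maximum of $f(P)$ over all $n$-point sets $P$ in general position, and $f^c(n)$ the maximum over all $n$-point sets $P$ in convex position. Put $\delta(n)=1$ for $n=0,1,3$ and $\delta(n)=0$ otherwise. Then for every $n\ge 0$ the following holds. 1. For every set $P$ of $n$ points in convex position, $$\mathrm{cov}(P)=\left\lfloor\tfrac{n+5}{2}\right\rfloor-\delta(n),\qquad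 \mathrm{cov}_\circ(P)=\left\lfloor\tfrac{2n+5}{3}\right\rfloor,$$ and, if $n\ge1$, also $\mathrm{enc}(P)=\left\lfloor\frac{n+5}{2}\right\rfloor-\delta(n)$ and $\mathrm{enc}_\circ(P)=\left\lfloor\frac{2n+5}{3}\right\rfloor$. Consequently $\mathrm{cov}^c(n)=\left\lfloor\frac{n+5}{2}\right\rfloor-\delta(n)$ and $\mathrm{cov}^c_\circ(n)=\left\lfloor\frac{2n+5}{3}\right\rfloor$, and, if $n\ge1$, also $\mathrm{enc}^c(n)=\left\lfloor\frac{n+5}{2}\right\rfloor-\delta(n)$ and $\mathrm{enc}^c_\circ(n)=\left\lfloor\frac{2n+5}{3}\right\rfloor$. 2. For every set $P$ of $n$ points in general position, $$\mathrm{enc}(P),\ \mathrm{cov}(P)\le\tfrac{7n}{11}+4,\qquad \mathrm{enc}_\circ(P),\ \mathrm{cov}_\circ(P)\le\left\lfloor\tfrac{2n+5}{3}\right\rfloor.$$ Consequently $\left\lfloor\frac{n+5}{2}\right\rfloor-\delta(n)\le\mathrm{cov}(n)\le\frac{7n}{11}+4$, $\mathrm{enc}(n)\le\frac{7n}{11}+4$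 and $\mathrm{cov}_\circ(n)=\left\lfloor\frac{2n+5}{3}\right\rfloor$, and, if $n\ge1$, also $\left\lfloor\frac{n+5}{2}\right\rfloor-\delta(n)\le\mathrm{enc}(n)$ and $\mathrm{enc}_\circ(n)=\left\lfloor\frac{2n+5}{3}\right\rfloor$. -/

import Mathlib

open scoped ENNReal Topology

/-- The Euclidean plane. -/
abbrev Plane : Type := EuclideanSpace ℝ (Fin 2)

/-- No three distinct points of `P` lie on a line. -/
def GeneralPosition (P : Finset Plane) : Prop :=
  ∀ a ∈ P, ∀ b ∈ P, ∀ c ∈ P, a ≠ b → a ≠ c → b ≠ c → ¬ Collinear ℝ ({a, b, c} : Set Plane)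

/-- No point of `P` lies in the convex hull of the other points of `P`. -/
def ConvexPosition (P : Finset Plane) : Prop :=
  ConvexIndependent ℝ ((↑) : P → Plane)

/-- The sets `K i` cover the complement of `P`, and are subsets of it. -/
def CoversCompl {k : ℕ} (K : Fin k → Set Plane) (P : Finset Plane) : Prop :=
  ⋃ i, K i = (P : Set Plane)ᶜ

/-- The union of the sets `K i` is, in some neighbourhood `N` of `p`, equal to `N` minus `p`. -/
def EncapsulatesPoint {k : ℕ} (K : Fin k → Set Plane) (p : Plane) : Prop :=
  ∃ N ∈ 𝓝 p, (⋃ i, K i) ∩ N = N \ {p}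

/-- The sets `K i` encapsulate every point of `P`. -/
def Encapsulates {k : ℕ} (K : Fin k → Set Plane) (P : Finset Plane) : Prop :=
  ∀ p ∈ P, EncapsulatesPoint K p

/-- The smallest number of convex sets that cover the complement of `P` (`⊤` if there is none). -/
noncomputable def cov (P : Finset Plane) : ℕ∞ :=
  ⨅ (k : ℕ) (_ : ∃ K : Fin k → Set Plane, (∀ i, Convex ℝ (K i)) ∧ CoversCompl K P), (k : ℕ∞)

/-- The smallest number of pairwise disjoint convex sets that cover the complement of `P`. -/
noncomputable def covDisj (P : Finset Plane) : ℕ∞ :=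
  ⨅ (k : ℕ) (_ : ∃ K : Fin k → Set Plane, (∀ i, Convex ℝ (K i)) ∧
    Pairwise (fun i j => Disjoint (K i) (K j)) ∧ CoversCompl K P), (k : ℕ∞)

/-- The smallest number of convex sets that encapsulate `P`. -/
noncomputable def enc (P : Finset Plane) : ℕ∞ :=
  ⨅ (k : ℕ) (_ : ∃ K : Fin k → Set Plane, (∀ i, Convex ℝ (K i)) ∧ Encapsulates K P), (k : ℕ∞)

/-- The smallest number of pairwise disjoint convex sets that encapsulate `P`. -/
noncomputable def encDisj (P : Finset Plane) : ℕ∞ :=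
  ⨅ (k : ℕ) (_ : ∃ K : Fin k → Set Plane, (∀ i, Convex ℝ (K i)) ∧
    Pairwise (fun i j => Disjoint (K i) (K j)) ∧ Encapsulates K P), (k : ℕ∞)

/-- The largest value of `f` over the `n`-point sets in general position. -/
noncomputable def maxGeneral (f : Finset Plane → ℕ∞) (n : ℕ) : ℕ∞ :=
  ⨆ (P : Finset Plane) (_ : GeneralPosition P ∧ P.card = n), f P

/-- The largest value of `f` over the `n`-point sets in convex position. -/
noncomputable def maxConvex (f : Finset Plane → ℕ∞) (n : ℕ) : ℕ∞ :=
  ⨆ (P : Finset Plane) (_ : ConvexPosition P ∧ P.card = n), f P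

/-- The correction term: `1` for `n = 0, 1, 3` and `0` otherwise. -/
def delta (n : ℕ) : ℕ := if n = 0 ∨ n = 1 ∨ n = 3 then 1 else 0

/-- `⌊(n + 5) / 2⌋ - δ(n)`; the natural-number subtraction never truncates here. -/
def convexBound (n : ℕ) : ℕ := (n + 5) / 2 - delta n

/-- `⌊(2 n + 5) / 3⌋`. -/
def disjointBound (n : ℕ) : ℕ := (2 * n + 5) / 3

/-!
Upper bounds. Let `x` and `y` be two points of the set. The line `x y` splits the plane in two, and
on one side the ray from a point of the segment `x y` to the first point `e` it meets when rotating
cuts off a convex region that contains no points. The rest of that side, like the other side, lies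
in a half-plane and is covered by sets for the points inside it, and `x`, `y`, `e` cost one more
set. If `e` is alone on its side, that side takes two sets in all and three points disappear, whence
`⌊(2 n + 5) / 3⌋` disjoint sets. Without disjointness, `m` disjoint hull edges cost only `m + 1`
sets, the `m` half-planes beyond them and one set inside the hull of their endpoints; for points in
convex position take every second edge of the polygon. In general, sort the points around a hull
vertex. If the first eight are hull vertices, they carry four disjoint hull edges, and eight points
cost five sets. Otherwise some line through two points has eight points on one side and crosses a
hull edge. These eight points, the two points on the line and the other end of the edge are eleven
points that cost seven sets.

Lower bounds for convex position. Colour each point by the convex sets that contain a germ of a ray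
from it. Each point has at least two colours, and two points together have at least three. If no two
sets meet in the hull, two colours never alternate along its boundary, and induction on such
colourings gives `2 n + 3 ≤ 3 k`. If two sets meet at a point `o` of the hull, then each point is
left in the direction away from `o` by some other set, and no set leaves three points in this way,
whence `n + 4 ≤ 2 k`.
-/

open AffineMap (lineMap lineMap_apply_zero lineMap_apply_one lineMap_apply_ring')

/-! ### Orientation -/

section Orientation

/-- Twice the signed area of the triangle `a b c`, as an affine function of `c`. It is positive
on the left of the directed line `a b`. -/
noncomputable def orient (a b : Plane) : Plane →ᵃ[ℝ] ℝ :=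
  (b 0 - a 0) • ((EuclideanSpace.proj 1 : Plane →L[ℝ] ℝ).toAffineMap - AffineMap.const ℝ _ (a 1)) -
    (b 1 - a 1) • ((EuclideanSpace.proj 0 : Plane →L[ℝ] ℝ).toAffineMap - AffineMap.const ℝ _ (a 0))

lemma orient_apply (a b c : Plane) :
    orient a b c = (b 0 - a 0) * (c 1 - a 1) - (b 1 - a 1) * (c 0 - a 0) := rfl

lemma orient_rotate (a b c : Plane) : orient b c a = orient a b c := by
  simp only [orient_apply]; ring

lemma orient_swap (a b c : Plane) : orient b a c = -orient a b c := by
  simp only [orient_apply]; ring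

lemma orient_swap_right (a b c : Plane) : orient a c b = -orient a b c := by
  simp only [orient_apply]; ring

@[simp] lemma orient_self (a b : Plane) : orient a a b = 0 := by simp [orient_apply]

@[simp] lemma orient_self_left (a b : Plane) : orient a b a = 0 := by simp [orient_apply]

@[simp] lemma orient_self_right (a b : Plane) : orient a b b = 0 := by
  simp only [orient_apply]; ring

lemma orient_add_orient_add_orient (a b c z : Plane) :
    orient b c z + orient c a z + orient a b z = orient a b c := by
  simp only [orient_apply]; ring

lemma exists_eq_lineMap_of_orient_eq_zero {a b c : Plane} (hab : a ≠ b) (h : orient a b c = 0) :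
    ∃ t : ℝ, c = lineMap a b t := by
  rw [orient_apply] at h
  have hne : b 0 - a 0 ≠ 0 ∨ b 1 - a 1 ≠ 0 := by
    by_contra! hz
    refine hab ?_
    ext i
    fin_cases i <;> simp only [Fin.zero_eta, Fin.mk_one] <;> linarith [hz.1, hz.2]
  rcases hne with h0 | h1
  · refine ⟨(c 0 - a 0) / (b 0 - a 0), ?_⟩
    ext i
    fin_cases i <;> simp only [AffineMap.lineMap_apply, vsub_eq_sub, vadd_eq_add, Fin.zero_eta,
      Fin.mk_one, PiLp.add_apply, PiLp.smul_apply, PiLp.sub_apply, smul_eq_mul] <;> field_simp <;>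
      linarith
  · refine ⟨(c 1 - a 1) / (b 1 - a 1), ?_⟩
    ext i
    fin_cases i <;> simp only [AffineMap.lineMap_apply, vsub_eq_sub, vadd_eq_add, Fin.zero_eta,
      Fin.mk_one, PiLp.add_apply, PiLp.smul_apply, PiLp.sub_apply, smul_eq_mul] <;> field_simp <;>
      linarith

lemma collinear_of_orient_eq_zero {a b c : Plane} (hab : a ≠ b) (h : orient a b c = 0) :
    Collinear ℝ ({a, b, c} : Set Plane) := by
  obtain ⟨t, rfl⟩ := exists_eq_lineMap_of_orient_eq_zero hab h
  rw [Set.insert_comm, Set.pair_comm, Set.insert_comm, Set.pair_comm]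
  exact collinear_insert_of_mem_affineSpan_pair (AffineMap.lineMap_mem_affineSpan_pair t a b)

end Orientation

namespace GeneralPosition

variable {P Q : Finset Plane}

lemma mono (hP : GeneralPosition P) (h : Q ⊆ P) : GeneralPosition Q :=
  fun a ha b hb c hc => hP a (h ha) b (h hb) c (h hc)

lemma orient_ne_zero (hP : GeneralPosition P) {a b c : Plane} (ha : a ∈ P) (hb : b ∈ P)
    (hc : c ∈ P) (hab : a ≠ b) (hac : a ≠ c) (hbc : b ≠ c) : orient a b c ≠ 0 :=
  fun h => hP a ha b hb c hc hab hac hbc (collinear_of_orient_eq_zero hab h)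

end GeneralPosition

namespace ConvexPosition

variable {P : Finset Plane}

lemma notMem_convexHull (hP : ConvexPosition P) {x : Plane} (hx : x ∈ P) :
    x ∉ convexHull ℝ ((P : Set Plane) \ {x}) :=
  (convexIndependent_set_iff_notMem_convexHull_sdiff (s := (P : Set Plane))).1 hP x hx

lemma not_wbtw (hP : ConvexPosition P) {a b c : Plane} (ha : a ∈ P) (hb : b ∈ P) (hc : c ∈ P)
    (hab : a ≠ b) (hbc : b ≠ c) : ¬Wbtw ℝ a b c :=
  fun h => hP.notMem_convexHull hb
    (segment_subset_convexHull (s := (P : Set Plane) \ {b}) ⟨ha, hab⟩ ⟨hc, hbc.symm⟩ h.mem_segment)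

lemma generalPosition (hP : ConvexPosition P) : GeneralPosition P := by
  intro a ha b hb c hc hab hac hbc h
  rcases h.wbtw_or_wbtw_or_wbtw with h | h | h
  · exact hP.not_wbtw ha hb hc hab hbc h
  · exact hP.not_wbtw hb hc ha hbc hac.symm h
  · exact hP.not_wbtw hc ha hb hac.symm hab h

end ConvexPosition

/-! ### Half-planes with part of their boundary -/

section Side

/-- The open ray that starts at `a`, lies on the line `a b` and points away from `b`. -/
def outerRay (a b : Plane) : Set Plane := lineMap a b '' Set.Iio (0 : ℝ)

/-- The open half-plane on the left of the directed line `a b`, together with the points of `S`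
on this line. -/
def side (a b : Plane) (S : Set Plane) : Set Plane :=
  {z | 0 < orient a b z ∨ orient a b z = 0 ∧ z ∈ S}

variable {a b z : Plane} {S T : Set Plane}

lemma convex_outerRay (a b : Plane) : Convex ℝ (outerRay a b) :=
  (convex_Iio 0).affine_image _

lemma lt_of_mem_outerRay {f : Plane →ᵃ[ℝ] ℝ} (hf : f b < f a) (hz : z ∈ outerRay a b) :
    f a < f z := by
  obtain ⟨t, ht, rfl⟩ := hz
  rw [AffineMap.apply_lineMap, lineMap_apply_ring']
  nlinarith [Set.mem_Iio.1 ht]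

lemma left_notMem_outerRay (hab : a ≠ b) : a ∉ outerRay a b := by
  rintro ⟨t, ht, h⟩
  have : t = 0 := AffineMap.lineMap_injective ℝ hab (h.trans (lineMap_apply_zero a b).symm)
  exact this.not_lt ht

lemma right_notMem_outerRay (hab : a ≠ b) : b ∉ outerRay a b := by
  rintro ⟨t, ht, h⟩
  have : t = 1 := AffineMap.lineMap_injective ℝ hab (h.trans (lineMap_apply_one a b).symm)
  linarith [Set.mem_Iio.1 ht]

lemma outerRay_swap (a b : Plane) : outerRay b a = lineMap a b '' Set.Ioi (1 : ℝ) := by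
  ext z
  constructor
  · rintro ⟨t, ht, rfl⟩
    exact ⟨1 - t, by rw [Set.mem_Ioi]; linarith [Set.mem_Iio.1 ht],
      AffineMap.lineMap_apply_one_sub a b t⟩
  · rintro ⟨t, ht, rfl⟩
    exact ⟨1 - t, by simpa using ht, AffineMap.lineMap_apply_one_sub b a t⟩

lemma disjoint_outerRay_outerRay (hab : a ≠ b) : Disjoint (outerRay a b) (outerRay b a) := by
  rw [outerRay_swap a b, outerRay]
  refine (Set.disjoint_image_iff (AffineMap.lineMap_injective ℝ hab)).2 ?_
  exact Set.disjoint_left.2 fun t ht ht' => by linarith [Set.mem_Iio.1 ht, Set.mem_Ioi.1 ht']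

lemma disjoint_openSegment_outerRay (hab : a ≠ b) :
    Disjoint (openSegment ℝ a b) (outerRay a b) := by
  rw [openSegment_eq_image_lineMap, outerRay]
  refine (Set.disjoint_image_iff (AffineMap.lineMap_injective ℝ hab)).2 ?_
  exact Set.disjoint_left.2 fun t ht ht' => lt_asymm ht.1 ht'

lemma line_cases (hab : a ≠ b) (h : orient a b z = 0) :
    z ∈ outerRay a b ∨ z = a ∨ z ∈ openSegment ℝ a b ∨ z = b ∨ z ∈ outerRay b a := by
  obtain ⟨t, rfl⟩ := exists_eq_lineMap_of_orient_eq_zero hab h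
  rcases lt_trichotomy t 0 with h0 | rfl | h0
  · exact Or.inl ⟨t, h0, rfl⟩
  · exact Or.inr (Or.inl (lineMap_apply_zero a b))
  rcases lt_trichotomy t 1 with h1 | rfl | h1
  · exact Or.inr (Or.inr (Or.inl (openSegment_eq_image_lineMap ℝ a b ▸ ⟨t, ⟨h0, h1⟩, rfl⟩)))
  · exact Or.inr (Or.inr (Or.inr (Or.inl (lineMap_apply_one a b))))
  · exact Or.inr (Or.inr (Or.inr (Or.inr (outerRay_swap a b ▸ ⟨t, h1, rfl⟩))))

lemma lineMap_mem_side {t : ℝ} (h : lineMap a b t ∈ S) : lineMap a b t ∈ side a b S :=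
  Or.inr ⟨by simp [AffineMap.apply_lineMap], h⟩

lemma left_notMem_side (h : a ∉ S) : a ∉ side a b S := fun ha => h (ha.resolve_left (by simp)).2

lemma right_notMem_side (h : b ∉ S) : b ∉ side a b S := fun hb => h (hb.resolve_left (by simp)).2

lemma side_mono (h : S ⊆ T) : side a b S ⊆ side a b T :=
  fun _ hz => hz.imp_right (And.imp_right (@h _))

lemma convex_side (a b : Plane) (hS : Convex ℝ S) : Convex ℝ (side a b S) := by
  rw [convex_iff_forall_pos]
  intro x hx y hy s t hs ht hst
  have hcomb : orient a b (s • x + t • y) = s * orient a b x + t * orient a b y :=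
    Convex.combo_affine_apply hst
  rcases hx with hx | ⟨hx, hxS⟩ <;> rcases hy with hy | ⟨hy, hyS⟩
  · exact Or.inl (by rw [hcomb]; positivity)
  · exact Or.inl (by rw [hcomb, hy]; nlinarith)
  · exact Or.inl (by rw [hcomb, hx]; nlinarith)
  · exact Or.inr ⟨by rw [hcomb, hx, hy]; ring, hS hxS hyS hs.le ht.le hst⟩

lemma side_union_side (a b : Plane) (S T : Set Plane) :
    side a b S ∪ side b a T = {z | orient a b z = 0 → z ∈ S ∪ T} := by
  ext z
  simp only [side, Set.mem_union, Set.mem_ofPred_eq, orient_swap a b, neg_eq_zero]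
  grind

lemma disjoint_side (h : Disjoint S T) : Disjoint (side a b S) (side b a T) := by
  refine Set.disjoint_left.2 fun z hz hz' => ?_
  simp only [side, Set.mem_ofPred_eq, orient_swap a b, neg_eq_zero] at hz hz'
  grind

lemma compl_side (a b : Plane) (S : Set Plane) : (side a b S)ᶜ = side b a Sᶜ := by
  ext z
  simp only [side, Set.mem_compl_iff, Set.mem_ofPred_eq, orient_swap a b, neg_eq_zero]
  grind

end Side

/-! ### Unions of convex sets -/

/-- The set `A` is a union of `k` convex sets, which are pairwise disjoint if `d` holds. The
parameter `d` lets one construction serve both for coverings and for disjoint coverings. -/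
def IsConvexUnion {E : Type*} [AddCommGroup E] [Module ℝ E] (d : Prop) (A : Set E) (k : ℕ) : Prop :=
  ∃ K : Fin k → Set E, (∀ i, Convex ℝ (K i)) ∧
    (d → Pairwise fun i j => Disjoint (K i) (K j)) ∧ ⋃ i, K i = A

namespace IsConvexUnion

variable {E : Type*} [AddCommGroup E] [Module ℝ E] {d : Prop} {A B C : Set E} {k l : ℕ}

lemma of_convex (d : Prop) (hA : Convex ℝ A) : IsConvexUnion d A 1 :=
  ⟨fun _ => A, fun _ => hA, fun _ => Subsingleton.pairwise, Set.iUnion_const A⟩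

lemma empty (d : Prop) (k : ℕ) : IsConvexUnion d (∅ : Set E) k :=
  ⟨fun _ => ∅, fun _ => convex_empty, fun _ _ _ _ => Set.disjoint_empty _, Set.iUnion_empty⟩

lemma union (hA : IsConvexUnion d A k) (hB : IsConvexUnion d B l) (hAB : d → Disjoint A B) :
    IsConvexUnion d (A ∪ B) (k + l) := by
  obtain ⟨K, hK, hKd, rfl⟩ := hA
  obtain ⟨L, hL, hLd, rfl⟩ := hB
  have hKL (h : d) (i : Fin k) (j : Fin l) : Disjoint (K i) (L j) :=
    (hAB h).mono (Set.subset_iUnion K i) (Set.subset_iUnion L j)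
  refine ⟨Fin.append K L, Fin.addCases (by simpa using hK) (by simpa using hL), fun h => ?_, ?_⟩
  · intro i j hij
    induction i using Fin.addCases <;> induction j using Fin.addCases <;>
      simp only [Fin.append_left, Fin.append_right]
    · exact hKd h (by simpa using hij)
    · exact hKL h _ _
    · exact (hKL h _ _).symm
    · exact hLd h (by simpa using hij)
  · ext z
    simp [finSumFinEquiv.symm.exists_congr_left]

lemma mono (h : IsConvexUnion d A k) (hkl : k ≤ l) : IsConvexUnion d A l := by
  have := h.union (empty d (l - k)) fun _ => Set.disjoint_empty A
  rwa [Set.union_empty, Nat.add_sub_cancel' hkl] at this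

lemma inter (h : IsConvexUnion d A k) (hC : Convex ℝ C) : IsConvexUnion d (A ∩ C) k := by
  obtain ⟨K, hK, hd, rfl⟩ := h
  exact ⟨fun i => K i ∩ C, fun i => (hK i).inter hC,
    fun h i j hij => (hd h hij).mono Set.inter_subset_left Set.inter_subset_left,
    (Set.iUnion_inter C K).symm⟩

lemma of_inter_of_inter_compl (h : IsConvexUnion d (A ∩ C) k) (h' : IsConvexUnion d (A ∩ Cᶜ) l) :
    IsConvexUnion d A (k + l) := by
  rw [← Set.inter_union_compl A C]
  exact h.union h' fun _ => disjoint_compl_right.mono Set.inter_subset_right Set.inter_subset_right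

end IsConvexUnion

/-! ### Angular order -/

section Angle

/-- The cotangent of the angle at `v` from the ray `v w` to the ray `v z`. It decreases along the
angular order of the points on one side of the line `v w`. -/
noncomputable def cot (v w z : Plane) : ℝ :=
  inner ℝ (w - v) (z - v) / orient v w z

variable {v w z z' : Plane}

lemma inner_mul_orient (v w z z' : Plane) :
    inner ℝ (w - v) (w - v) * orient v z z' =
      inner ℝ (w - v) (z - v) * orient v w z' - inner ℝ (w - v) (z' - v) * orient v w z := by
  simp only [PiLp.inner_apply, Fin.sum_univ_two, RCLike.inner_apply, conj_trivial, orient_apply,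
    PiLp.sub_apply]
  ring

lemma inner_mul_orient_eq_mul_cot_sub_cot (hz : orient v w z ≠ 0) (hz' : orient v w z' ≠ 0) :
    inner ℝ (w - v) (w - v) * orient v z z' =
      orient v w z * orient v w z' * (cot v w z - cot v w z') := by
  rw [inner_mul_orient, cot, cot]
  field_simp

lemma inner_sub_self_pos (hz : orient v w z ≠ 0) : 0 < inner ℝ (w - v) (w - v) := by
  refine real_inner_self_pos.2 (sub_ne_zero.2 ?_)
  rintro rfl
  simp at hz

lemma orient_pos_iff_cot_lt_cot (hz : 0 < orient v w z) (hz' : 0 < orient v w z') :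
    0 < orient v z z' ↔ cot v w z' < cot v w z := by
  rw [← mul_pos_iff_of_pos_left (inner_sub_self_pos hz.ne'),
    inner_mul_orient_eq_mul_cot_sub_cot hz.ne' hz'.ne',
    mul_pos_iff_of_pos_left (mul_pos hz hz'), sub_pos]

end Angle

section Generic

variable {x y z : Plane} {P : Finset Plane}

lemma orient_lineMap_left (x y z : Plane) (c : ℝ) :
    orient (lineMap x y c) y z = (1 - c) * orient x y z := by
  simp only [orient_apply, AffineMap.lineMap_apply, vsub_eq_sub, vadd_eq_add, PiLp.add_apply,
    PiLp.smul_apply, PiLp.sub_apply, smul_eq_mul]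
  ring

lemma orient_lineMap_right (x y z : Plane) (c : ℝ) :
    orient x (lineMap x y c) z = c * orient x y z := by
  simp only [orient_apply, AffineMap.lineMap_apply, vsub_eq_sub, vadd_eq_add, PiLp.add_apply,
    PiLp.smul_apply, PiLp.sub_apply, smul_eq_mul]
  ring

lemma exists_mem_openSegment_orient_ne_zero (L : Finset Plane)
    (hL : ∀ f ∈ L, ∀ g ∈ L, f ≠ g → orient f g x ≠ 0) :
    ∃ z ∈ openSegment ℝ x y, ∀ f ∈ L, ∀ g ∈ L, f ≠ g → orient f g z ≠ 0 := by
  have hfin : (⋃ p ∈ L.offDiag, {c : ℝ | orient p.1 p.2 (lineMap x y c) = 0}).Finite := by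
    refine Set.Finite.biUnion L.offDiag.finite_toSet fun p hp => Set.Subsingleton.finite ?_
    obtain ⟨hf, hg, hfg⟩ := Finset.mem_offDiag.1 hp
    intro c hc e he
    simp only [Set.mem_ofPred_eq, AffineMap.apply_lineMap, lineMap_apply_ring'] at hc he
    by_contra hne
    have hslope : orient p.1 p.2 y - orient p.1 p.2 x = 0 :=
      (mul_eq_zero.1 (show (c - e) * _ = 0 by linarith)).resolve_left (sub_ne_zero.2 hne)
    rw [hslope, mul_zero, zero_add] at hc
    exact hL _ hf _ hg hfg hc
  obtain ⟨c, hc, hc'⟩ := (Set.Ioo_infinite (zero_lt_one' ℝ)).exists_notMem_finite hfin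
  refine ⟨lineMap x y c, openSegment_eq_image_lineMap ℝ x y ▸ ⟨c, hc, rfl⟩,
    fun f hf g hg hfg h => hc' ?_⟩
  exact Set.mem_biUnion (x := (f, g)) (Finset.mem_offDiag.2 ⟨hf, hg, hfg⟩) h

/-- The points of `P` strictly to the left of the directed line `x y`; those strictly to the right
are `leftOf P y x`. -/
noncomputable def leftOf (P : Finset Plane) (x y : Plane) : Finset Plane :=
  {z ∈ P | 0 < orient x y z}

lemma mem_leftOf : z ∈ leftOf P x y ↔ z ∈ P ∧ 0 < orient x y z := Finset.mem_filter

lemma leftOf_subset (P : Finset Plane) (x y : Plane) : leftOf P x y ⊆ P :=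
  Finset.filter_subset _ _

end Generic

namespace GeneralPosition

variable {P : Finset Plane} {x y z : Plane}

lemma eq_or_eq_of_orient_eq_zero (hP : GeneralPosition P) (hx : x ∈ P) (hy : y ∈ P) (hz : z ∈ P)
    (hxy : x ≠ y) (h : orient x y z = 0) : z = x ∨ z = y := by
  by_contra! hne
  exact hP.orient_ne_zero hx hy hz hxy hne.1.symm hne.2.symm h

lemma card_leftOf_add_card_leftOf (hP : GeneralPosition P) (hx : x ∈ P) (hy : y ∈ P)
    (hxy : x ≠ y) : (leftOf P x y).card + (leftOf P y x).card + 2 = P.card := by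
  have hline : P.filter (fun z => ¬0 < orient x y z ∧ ¬0 < orient y x z) = {x, y} := by
    ext z
    simp only [Finset.mem_filter, Finset.mem_insert, Finset.mem_singleton, orient_swap x y]
    constructor
    · rintro ⟨hz, h1, h2⟩
      exact hP.eq_or_eq_of_orient_eq_zero hx hy hz hxy (by linarith)
    · rintro (rfl | rfl) <;> simp [*]
  have hright : leftOf P y x = P.filter (fun z => ¬0 < orient x y z ∧ 0 < orient y x z) :=
    Finset.filter_congr fun z _ => by rw [orient_swap x y]; grind
  have hleft := Finset.card_filter_add_card_filter_not (s := P) (fun z => 0 < orient x y z)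
  have hnot := Finset.card_filter_add_card_filter_not (s := P.filter fun z => ¬0 < orient x y z)
    (fun z => 0 < orient y x z)
  rw [Finset.filter_filter, Finset.filter_filter, hline, ← hright, Finset.card_pair hxy] at hnot
  rw [leftOf]
  omega

lemma exists_first_leftOf (hP : GeneralPosition P) (hx : x ∈ P) (hne : (leftOf P x y).Nonempty) :
    ∃ Z ∈ openSegment ℝ x y, ∃ e ∈ leftOf P x y, ∀ f ∈ leftOf P x y, f ≠ e → 0 < orient Z e f := by
  have hmem {f : Plane} (hf : f ∈ leftOf P x y) := mem_leftOf.1 hf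
  have hnx {f : Plane} (hf : f ∈ leftOf P x y) : f ≠ x := by
    rintro rfl
    simpa using (hmem hf).2
  obtain ⟨Z, hZ, hgen⟩ := exists_mem_openSegment_orient_ne_zero (y := y) (leftOf P x y)
    fun f hf g hg hfg => hP.orient_ne_zero (hmem hf).1 (hmem hg).1 hx hfg (hnx hf) (hnx hg)
  obtain ⟨e, he, hmax⟩ := (leftOf P x y).exists_max_image (cot Z y) hne
  refine ⟨Z, hZ, e, he, fun f hf hfe => ?_⟩
  have hpos {f : Plane} (hf : f ∈ leftOf P x y) : 0 < orient Z y f := by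
    obtain ⟨c, hc, rfl⟩ := openSegment_eq_image_lineMap ℝ x y ▸ hZ
    rw [orient_lineMap_left]
    exact mul_pos (sub_pos.2 hc.2) (hmem hf).2
  refine lt_of_le_of_ne (not_lt.1 fun h => (hmax f hf).not_gt ?_)
    fun h => hgen e he f hf hfe.symm ((orient_rotate Z e f).trans h.symm)
  rwa [← orient_pos_iff_cot_lt_cot (hpos hf) (hpos he), orient_swap_right, neg_pos]

end GeneralPosition

/-! ### Splitting along a line through two points -/

section Split

variable {d : Prop} {P : Finset Plane} {x y z Z e : Plane} {m k : ℕ}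

lemma outerRay_subset_compl_openSegment (hxy : x ≠ y) :
    outerRay x y ⊆ (openSegment ℝ x y)ᶜ :=
  (disjoint_openSegment_outerRay hxy).subset_compl_left

lemma GeneralPosition.notMem_of_mem_outerRay (hP : GeneralPosition P) (hx : x ∈ P) (hy : y ∈ P)
    (hxy : x ≠ y) (hz : z ∈ outerRay x y) : z ∉ P := by
  intro hzP
  have h0 : orient x y z = 0 := by
    obtain ⟨t, -, rfl⟩ := hz
    simp [AffineMap.apply_lineMap]
  rcases hP.eq_or_eq_of_orient_eq_zero hx hy hzP hxy h0 with rfl | rfl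
  · exact left_notMem_outerRay hxy hz
  · exact right_notMem_outerRay hxy hz

lemma orient_of_mem_openSegment (hZ : Z ∈ openSegment ℝ x y) (he : 0 < orient x y e) :
    orient x y Z = 0 ∧ orient e Z x < 0 ∧ 0 < orient e Z y := by
  obtain ⟨c, hc, rfl⟩ := openSegment_eq_image_lineMap ℝ x y ▸ hZ
  refine ⟨by simp [AffineMap.apply_lineMap], ?_, ?_⟩
  · rw [orient_swap, orient_rotate, orient_lineMap_right, neg_neg_iff_pos]
    exact mul_pos hc.1 he
  · rw [orient_rotate, orient_rotate, orient_lineMap_left]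
    exact mul_pos (sub_pos.2 hc.2) he

/-- The part of the complement of `P` on the left of the directed line `x y`, where the line counts
as left outside of the segment between `x` and `y`. -/
def leftRegion (P : Finset Plane) (x y : Plane) : Set Plane :=
  (P : Set Plane)ᶜ ∩ side x y (openSegment ℝ x y)ᶜ

/-- The part of the complement of `P` that is not in `leftRegion P x y`: the right of the directed
line `x y` with the open segment between `x` and `y`. -/
def rightRegion (P : Finset Plane) (x y : Plane) : Set Plane :=
  (P : Set Plane)ᶜ ∩ (side x y (openSegment ℝ x y)ᶜ)ᶜ

/-- The outer ray beyond `x` is the only part of the line `x y` in this piece, as `y` lies strictly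
to the right of `Z e`. -/
lemma leftRegion_inter_side (hP : GeneralPosition P) (hx : x ∈ P) (hy : y ∈ P) (hxy : x ≠ y)
    (hZ : Z ∈ openSegment ℝ x y) (he : e ∈ leftOf P x y) :
    leftRegion P x y ∩ side Z e (openSegment ℝ Z e) =
      ((leftOf P x y).erase e : Set Plane)ᶜ ∩ (side x y (outerRay x y) ∩
        side Z e (openSegment ℝ Z e)) := by
  obtain ⟨-, hZx, hZy⟩ := orient_of_mem_openSegment hZ (mem_leftOf.1 he).2
  have hZe : Z ≠ e := fun h => by simp [h] at hZy
  rw [← Set.inter_assoc]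
  ext z
  refine and_congr_left fun hzC => ⟨?_, ?_⟩
  · rintro ⟨hzP, hz⟩
    refine ⟨fun h => hzP (leftOf_subset P x y (Finset.mem_of_mem_erase h)),
      hz.imp_right fun ⟨h0, hseg⟩ => ⟨h0, ?_⟩⟩
    rcases line_cases hxy h0 with h | rfl | h | rfl | h
    · exact h
    · exact absurd hx hzP
    · exact absurd h hseg
    · exact absurd hy hzP
    · have hyz := lt_of_mem_outerRay (hZx.trans hZy) h
      have hz0 : 0 ≤ orient Z e z := hzC.elim le_of_lt fun h => h.1.ge
      linarith [orient_swap Z e z]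
  · rintro ⟨hzL, hz⟩
    refine ⟨fun hzP => ?_, side_mono (outerRay_subset_compl_openSegment hxy) hz⟩
    rcases hz with h | ⟨-, hray⟩
    · refine hzL (Finset.mem_erase.2 ⟨?_, mem_leftOf.2 ⟨hzP, h⟩⟩)
      rintro rfl
      exact hZe (right_mem_openSegment_iff.1 (hzC.resolve_left (by simp)).2)
    · exact hP.notMem_of_mem_outerRay hx hy hxy hray hzP

lemma leftRegion_inter_compl_side (hP : GeneralPosition P) (hx : x ∈ P) (hy : y ∈ P) (hxy : x ≠ y)
    (hZ : Z ∈ openSegment ℝ x y) (he : e ∈ leftOf P x y)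
    (hfirst : ∀ f ∈ leftOf P x y, f ≠ e → 0 < orient Z e f) :
    leftRegion P x y ∩ (side Z e (openSegment ℝ Z e))ᶜ =
      side x y (outerRay y x) ∩ side e Z (outerRay e Z) := by
  obtain ⟨heP, hxye⟩ := mem_leftOf.1 he
  obtain ⟨hZ0, hZx, hZy⟩ := orient_of_mem_openSegment hZ hxye
  have hZe : Z ≠ e := fun h => by simp [h] at hZy
  rw [compl_side]
  ext z
  constructor
  · rintro ⟨⟨hzP, hz⟩, hzC⟩
    have hz0 : 0 ≤ orient e Z z := hzC.elim le_of_lt fun h => h.1.ge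
    rcases hz with h | ⟨h0, hseg⟩
    · refine ⟨Or.inl h, hzC.imp_right fun ⟨h0, hseg⟩ => ⟨h0, ?_⟩⟩
      rcases line_cases hZe.symm h0 with h' | rfl | h' | rfl | h'
      · exact h'
      · exact absurd heP hzP
      · exact absurd (openSegment_symm ℝ e Z ▸ h') hseg
      · exact absurd hZ0 h.ne'
      · have hZz := lt_of_mem_outerRay (f := orient y x) (a := Z) (b := e) (z := z)
          (by linarith [orient_swap x y Z, orient_swap x y e]) h'
        linarith [orient_swap x y Z, orient_swap x y z]
    · rcases line_cases hxy h0 with h | rfl | h | rfl | h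
      · have hxz := lt_of_mem_outerRay (f := orient Z e) (a := x) (b := y) (z := z)
          (by linarith [orient_swap Z e x, orient_swap Z e y]) h
        linarith [orient_swap Z e x, orient_swap Z e z]
      · exact absurd hx hzP
      · exact absurd h hseg
      · exact absurd hy hzP
      · have hyz := lt_of_mem_outerRay (hZx.trans hZy) h
        exact ⟨Or.inr ⟨h0, h⟩, Or.inl (hZy.trans hyz)⟩
  · rintro ⟨hz, hzC⟩
    refine ⟨⟨fun hzP => ?_, side_mono ?_ hz⟩, side_mono ?_ hzC⟩
    · rcases hz with h | ⟨-, hray⟩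
      · by_cases hze : z = e
        · subst hze
          exact left_notMem_outerRay hZe.symm (hzC.resolve_left (by simp)).2
        · have hz0 : 0 ≤ orient e Z z := hzC.elim le_of_lt fun h => h.1.ge
          linarith [hfirst z (mem_leftOf.2 ⟨hzP, h⟩) hze, orient_swap Z e z]
      · exact hP.notMem_of_mem_outerRay hy hx hxy.symm hray hzP
    · exact openSegment_symm ℝ x y ▸ outerRay_subset_compl_openSegment hxy.symm
    · exact openSegment_symm ℝ Z e ▸ outerRay_subset_compl_openSegment hZe.symm

lemma GeneralPosition.isConvexUnion_leftRegion (hP : GeneralPosition P) (hx : x ∈ P) (hy : y ∈ P)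
    (hxy : x ≠ y) (hne : (leftOf P x y).Nonempty)
    (hm : ∀ e ∈ leftOf P x y, IsConvexUnion d ((leftOf P x y).erase e : Set Plane)ᶜ m) :
    IsConvexUnion d (leftRegion P x y) (m + 1) := by
  obtain ⟨Z, hZ, e, he, hfirst⟩ := hP.exists_first_leftOf hx hne
  refine IsConvexUnion.of_inter_of_inter_compl (C := side Z e (openSegment ℝ Z e)) ?_ ?_
  · rw [leftRegion_inter_side hP hx hy hxy hZ he]
    exact (hm e he).inter ((convex_side x y (convex_outerRay x y)).inter
      (convex_side Z e (convex_openSegment Z e)))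
  · rw [leftRegion_inter_compl_side hP hx hy hxy hZ he hfirst]
    exact .of_convex d ((convex_side x y (convex_outerRay y x)).inter
      (convex_side e Z (convex_outerRay e Z)))

lemma GeneralPosition.isConvexUnion_rightRegion (hP : GeneralPosition P) (hx : x ∈ P) (hy : y ∈ P)
    (hxy : x ≠ y) (hk : IsConvexUnion d (leftOf P y x : Set Plane)ᶜ k) :
    IsConvexUnion d (rightRegion P x y) k := by
  rw [rightRegion, compl_side, compl_compl]
  have hright : (P : Set Plane)ᶜ ∩ side y x (openSegment ℝ x y) =
      (leftOf P y x : Set Plane)ᶜ ∩ side y x (openSegment ℝ x y) := by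
    ext z
    refine and_congr_left fun hz => not_congr ⟨fun hzP => mem_leftOf.2 ⟨hzP, ?_⟩,
      fun h => leftOf_subset P y x h⟩
    refine hz.resolve_right fun ⟨h0, hseg⟩ => ?_
    rcases hP.eq_or_eq_of_orient_eq_zero hy hx hzP hxy.symm h0 with rfl | rfl
    · exact hxy (right_mem_openSegment_iff.1 hseg)
    · exact hxy (left_mem_openSegment_iff.1 hseg)
  rw [hright]
  exact hk.inter (convex_side y x (convex_openSegment x y))

lemma GeneralPosition.isConvexUnion_split (hP : GeneralPosition P) (hx : x ∈ P) (hy : y ∈ P)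
    (hxy : x ≠ y) (hne : (leftOf P x y).Nonempty)
    (hm : ∀ e ∈ leftOf P x y, IsConvexUnion d ((leftOf P x y).erase e : Set Plane)ᶜ m)
    (hk : IsConvexUnion d (leftOf P y x : Set Plane)ᶜ k) :
    IsConvexUnion d (P : Set Plane)ᶜ (m + 1 + k) :=
  (hP.isConvexUnion_leftRegion hx hy hxy hne hm).of_inter_of_inter_compl
    (hP.isConvexUnion_rightRegion hx hy hxy hk)

end Split

/-! ### Enumeration in counterclockwise order -/

section Enumeration

lemma exists_bijOn_Iio_strictMonoOn {α β : Type*} [Nonempty α] [LinearOrder β] {P : Finset α}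
    {key : α → β} (hkey : Set.InjOn key P) :
    ∃ f : ℕ → α, Set.BijOn f (Set.Iio P.card) P ∧ StrictMonoOn (key ∘ f) (Set.Iio P.card) := by
  classical
  let e := (P.image key).orderEmbOfFin (Finset.card_image_of_injOn hkey)
  have he (i : Fin P.card) : ∃ z ∈ P, key z = e i :=
    Finset.mem_image.1 (Finset.orderEmbOfFin_mem _ _ i)
  choose g hgP hge using he
  let f (i : ℕ) : α := if h : i < P.card then g ⟨i, h⟩ else Classical.arbitrary α
  have hf {i : ℕ} (h : i < P.card) : f i = g ⟨i, h⟩ := dif_pos h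
  have hmono : StrictMonoOn (key ∘ f) (Set.Iio P.card) := by
    intro i hi j hj hij
    rw [Function.comp_apply, Function.comp_apply, hf hi, hf hj, hge, hge]
    exact e.strictMono hij
  have hmaps : Set.MapsTo f (Set.Iio P.card) P := fun i hi => hf hi ▸ hgP _
  refine ⟨f, ⟨hmaps, fun i hi j hj h => hmono.injOn hi hj (congrArg key h), fun z hz => ?_⟩, hmono⟩
  have hrange : key z ∈ Set.range e := by
    rw [Finset.range_orderEmbOfFin]
    exact Finset.mem_image_of_mem key hz
  obtain ⟨i, hi⟩ := hrange
  exact ⟨i, i.2, hkey (hmaps i.2) hz (by rw [hf i.2, hge, ← hi])⟩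

lemma exists_forall_orient_pos {P : Finset Plane} (hne : P.Nonempty) :
    ∃ v ∈ P, ∃ w, ∀ z ∈ P, z ≠ v → 0 < orient v w z := by
  obtain ⟨v, hv, hmax⟩ := P.exists_max_image (fun z => z 0 ^ 2 + z 1 ^ 2) hne
  refine ⟨v, hv, !₂[v 0 - v 1, v 1 + v 0], fun z hz hzv => ?_⟩
  have hdist : 0 < (z 0 - v 0) ^ 2 + (z 1 - v 1) ^ 2 := by
    by_contra! h
    refine hzv (PiLp.ext fun i => ?_)
    fin_cases i <;> simp only [Fin.zero_eta, Fin.mk_one] <;> nlinarith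
  simp only [orient_apply, Matrix.cons_val_zero, Matrix.cons_val_one]
  linarith [hmax z hz]

/-- The list starts with a vertex of the convex hull, around which the other points are sorted. -/
lemma GeneralPosition.exists_bijOn_orient_pos {P : Finset Plane} (hP : GeneralPosition P) :
    ∃ f : ℕ → Plane, Set.BijOn f (Set.Iio P.card) P ∧
      ∀ i j, 0 < i → i < j → j < P.card → 0 < orient (f 0) (f i) (f j) := by
  classical
  rcases P.eq_empty_or_nonempty with rfl | hne
  · exact ⟨fun _ => 0, by simp, by simp⟩
  obtain ⟨v, hv, w, hw⟩ := exists_forall_orient_pos hne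
  let key (z : Plane) : WithBot ℝ := if z = v then ⊥ else (-cot v w z : ℝ)
  have hkey_lt {z z' : Plane} (hz : z ∈ P) (hzv : z ≠ v) (hz' : z' ∈ P) (hzv' : z' ≠ v) :
      key z < key z' ↔ 0 < orient v z z' := by
    simp only [key, if_neg hzv, if_neg hzv', WithBot.coe_lt_coe, neg_lt_neg_iff]
    exact (orient_pos_iff_cot_lt_cot (hw z hz hzv) (hw z' hz' hzv')).symm
  have hkey : Set.InjOn key P := by
    intro z hz z' hz' h
    by_contra hzz'
    by_cases hzv : z = v
    · simp [key, hzv, Ne.symm (hzv ▸ hzz')] at h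
    by_cases hzv' : z' = v
    · simp [key, hzv, hzv'] at h
    have hpos := (hkey_lt hz hzv hz' hzv').not.1 h.not_lt
    have hneg := (hkey_lt hz' hzv' hz hzv).not.1 h.not_gt
    rw [orient_swap_right] at hneg
    exact hP.orient_ne_zero hv hz hz' (Ne.symm hzv) (Ne.symm hzv') hzz' (by linarith)
  obtain ⟨f, hf, hmono⟩ := exists_bijOn_Iio_strictMonoOn hkey
  have h0 : f 0 = v := by
    obtain ⟨i, hi, rfl⟩ := hf.surjOn hv
    by_contra h
    have hi0 : 0 < i := Nat.pos_of_ne_zero fun hi0 => h (by rw [hi0])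
    simpa [key] using hmono (hi0.trans hi) hi hi0
  refine ⟨f, hf, fun i j hi hij hj => ?_⟩
  have hne0 {k : ℕ} (hk : 0 < k) (hkP : k < P.card) : f k ≠ v :=
    h0 ▸ fun h => hk.ne' (hf.injOn hkP (hk.trans hkP) h)
  rw [h0, ← hkey_lt (hf.mapsTo (hij.trans hj)) (hne0 hi (hij.trans hj)) (hf.mapsTo hj)
    (hne0 (hi.trans hij) hj)]
  exact hmono (hij.trans hj) hj hij

end Enumeration

/-! ### The upper bound for general position -/

section DisjointBound

variable {P : Finset Plane} {d : Prop}

lemma isConvexUnion_compl_singleton (d : Prop) (a : Plane) :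
    IsConvexUnion d ({a}ᶜ : Set Plane) 2 := by
  obtain ⟨b, hb⟩ := exists_ne a
  have hinj := AffineMap.lineMap_injective ℝ hb.symm
  let S := lineMap a b '' Set.Ioi (0 : ℝ)
  have hunion : side a b (outerRay a b) ∪ side b a S = ({a}ᶜ : Set Plane) := by
    rw [side_union_side, outerRay, ← Set.image_union, Set.Iio_union_Ioi]
    ext z
    constructor
    · rintro hz rfl
      obtain ⟨t, ht, h⟩ := hz (orient_self_left z b)
      exact ht (hinj (h.trans (lineMap_apply_zero z b).symm))
    · intro hz h0
      obtain ⟨t, rfl⟩ := exists_eq_lineMap_of_orient_eq_zero hb.symm h0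
      exact ⟨t, by rintro rfl; simp at hz, rfl⟩
  rw [← hunion]
  exact (IsConvexUnion.of_convex d (convex_side a b (convex_outerRay a b))).union
    (.of_convex d (convex_side b a ((convex_Ioi 0).affine_image _)))
    fun _ => disjoint_side ((Set.disjoint_image_iff hinj).2 (by simp))

lemma isConvexUnion_compl_pair (d : Prop) {x y : Plane} (hxy : x ≠ y) :
    IsConvexUnion d ({x, y}ᶜ : Set Plane) 3 := by
  have hunion : side x y (outerRay x y) ∪ side y x (outerRay y x) ∪ openSegment ℝ x y =
      ({x, y}ᶜ : Set Plane) := by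
    rw [side_union_side]
    ext z
    constructor
    · rintro hz (rfl | rfl)
      · rcases hz with hz | hz
        · exact (hz (orient_self_left z y)).elim (left_notMem_outerRay hxy)
            (right_notMem_outerRay hxy.symm)
        · exact hxy (left_mem_openSegment_iff.1 hz)
      · rcases hz with hz | hz
        · exact (hz (orient_self_right x z)).elim (right_notMem_outerRay hxy)
            (left_notMem_outerRay hxy.symm)
        · exact hxy (right_mem_openSegment_iff.1 hz)
    · intro hz
      refine or_iff_not_imp_right.2 fun hseg h0 => ?_
      rcases line_cases hxy h0 with h | rfl | h | rfl | h
      · exact Or.inl h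
      · simp at hz
      · exact absurd h hseg
      · simp at hz
      · exact Or.inr h
  have hdisj : Disjoint (side x y (outerRay x y) ∪ side y x (outerRay y x))
      (openSegment ℝ x y) := by
    rw [side_union_side]
    refine Set.disjoint_left.2 fun z hz hseg => ?_
    have h0 : orient x y z = 0 := by
      obtain ⟨t, -, rfl⟩ := openSegment_eq_image_lineMap ℝ x y ▸ hseg
      simp [AffineMap.apply_lineMap]
    exact (hz h0).elim (Set.disjoint_left.1 (disjoint_openSegment_outerRay hxy) hseg)
      (Set.disjoint_left.1 (disjoint_openSegment_outerRay hxy.symm)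
        (openSegment_symm ℝ x y ▸ hseg))
  rw [← hunion]
  exact ((IsConvexUnion.of_convex d (convex_side x y (convex_outerRay x y))).union
    (.of_convex d (convex_side y x (convex_outerRay y x)))
    fun _ => disjoint_side (disjoint_outerRay_outerRay hxy)).union
    (.of_convex d (convex_openSegment x y)) fun _ => hdisj

lemma isConvexUnion_compl_of_card_le_two (hP : P.card ≤ 2) :
    IsConvexUnion d (P : Set Plane)ᶜ (P.card + 1) := by
  obtain h | h | h : P.card = 0 ∨ P.card = 1 ∨ P.card = 2 := by omega
  · rw [h, Finset.card_eq_zero.1 h, Finset.coe_empty, Set.compl_empty]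
    exact .of_convex d convex_univ
  · obtain ⟨a, rfl⟩ := Finset.card_eq_one.1 h
    simpa using isConvexUnion_compl_singleton d a
  · obtain ⟨x, y, hxy, rfl⟩ := Finset.card_eq_two.1 h
    simpa [hxy] using isConvexUnion_compl_pair d hxy

lemma leftOf_eq_singleton {f : ℕ → Plane} (hf : Set.BijOn f (Set.Iio P.card) P) (h3 : 3 ≤ P.card)
    (hpos : ∀ i j, 0 < i → i < j → j < P.card → 0 < orient (f 0) (f i) (f j)) :
    leftOf P (f 2) (f 0) = {f 1} := by
  ext z
  rw [mem_leftOf, Finset.mem_singleton]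
  constructor
  · rintro ⟨hz, hleft⟩
    obtain ⟨i, hi, rfl⟩ := hf.surjOn hz
    rw [orient_swap] at hleft
    obtain rfl | rfl | rfl | h : i = 0 ∨ i = 1 ∨ i = 2 ∨ 2 < i := by omega
    · simp at hleft
    · rfl
    · simp at hleft
    · linarith [hpos 2 i two_pos h hi]
  · rintro rfl
    refine ⟨hf.mapsTo (show 1 < P.card by omega), ?_⟩
    rw [← orient_rotate]
    exact hpos 1 2 one_pos one_lt_two h3

theorem GeneralPosition.isConvexUnion_disjointBound (d : Prop) (hP : GeneralPosition P) :
    IsConvexUnion d (P : Set Plane)ᶜ (disjointBound P.card) := by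
  induction hn : P.card using Nat.strong_induction_on generalizing P with
  | _ n ih =>
  subst hn
  rcases le_or_gt P.card 2 with h2 | h3
  · refine (isConvexUnion_compl_of_card_le_two h2).mono ?_
    unfold disjointBound
    omega
  obtain ⟨f, hf, hpos⟩ := hP.exists_bijOn_orient_pos
  have hleft := leftOf_eq_singleton hf h3 hpos
  have hx : f 2 ∈ P := hf.mapsTo h3
  have hy : f 0 ∈ P := hf.mapsTo (Nat.zero_lt_of_lt h3)
  have hxy : f 2 ≠ f 0 :=
    hf.injOn.ne (x := 2) (y := 0) h3 (Nat.zero_lt_of_lt h3) two_ne_zero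
  have hcard := hP.card_leftOf_add_card_leftOf hx hy hxy
  rw [hleft, Finset.card_singleton] at hcard
  refine (hP.isConvexUnion_split (m := 1) hx hy hxy (by simp [hleft]) (fun e he => ?_)
    (ih _ (by omega) (hP.mono (leftOf_subset P (f 0) (f 2))) rfl)).mono ?_
  · rw [hleft, Finset.mem_singleton] at he
    simpa [hleft, he] using IsConvexUnion.of_convex d convex_univ
  · unfold disjointBound
    omega

end DisjointBound

/-! ### Disjoint hull edges -/

/-- The segment `a b` is an edge of the convex hull of `P`, directed so that all the other points
of `P` lie on its left. -/
structure IsHullEdge (P : Finset Plane) (a b : Plane) : Prop where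
  left_mem : a ∈ P
  right_mem : b ∈ P
  ne : a ≠ b
  orient_pos : ∀ z ∈ P, z ≠ a → z ≠ b → 0 < orient a b z

namespace IsHullEdge

variable {P : Finset Plane} {a b z : Plane} {S : Set Plane}

lemma notMem_side (h : IsHullEdge P a b) (ha : a ∉ S) (hb : b ∉ S) (hz : z ∈ P) :
    z ∉ side b a S := by
  by_cases hza : z = a
  · subst hza
    exact right_notMem_side ha
  by_cases hzb : z = b
  · subst hzb
    exact left_notMem_side hb
  have hpos := h.orient_pos z hz hza hzb
  rintro (hz' | ⟨hz', -⟩) <;> linarith [orient_swap a b z]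

lemma mem_side_or_mem_openSegment (h : IsHullEdge P a b) (hz : z ∉ P)
    (hz' : z ∉ side a b (outerRay a b)) :
    z ∈ side b a (outerRay b a) ∨ z ∈ openSegment ℝ a b := by
  rw [← Set.mem_compl_iff, compl_side] at hz'
  rcases hz' with hpos | ⟨h0, hray⟩
  · exact Or.inl (Or.inl hpos)
  rcases line_cases h.ne.symm h0 with h' | rfl | h' | rfl | h'
  · exact Or.inl (Or.inr ⟨h0, h'⟩)
  · exact absurd h.right_mem hz
  · exact Or.inr (openSegment_symm ℝ a b ▸ h')
  · exact absurd h.left_mem hz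
  · exact absurd h' hray

end IsHullEdge

section Matching

variable {P : Finset Plane} {m k : ℕ}

lemma openSegment_subset_iInter_side {a b : Fin m → Plane} (hab : ∀ i, IsHullEdge P (a i) (b i))
    (hdisj : Pairwise fun i j => Disjoint ({a i, b i} : Set Plane) {a j, b j}) (i : Fin m) :
    openSegment ℝ (a i) (b i) ⊆ ⋂ j, side (a j) (b j) (openSegment ℝ (a j) (b j)) := by
  intro z hz
  refine Set.mem_iInter.2 fun j => ?_
  obtain ⟨c, hc, rfl⟩ := openSegment_eq_image_lineMap ℝ (a i) (b i) ▸ hz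
  rcases eq_or_ne i j with rfl | hij
  · exact lineMap_mem_side hz
  have hpos {z : Plane} (hz : z ∈ ({a i, b i} : Set Plane)) (hzP : z ∈ P) :
      0 < orient (a j) (b j) z := by
    have hz' := Set.disjoint_left.1 (hdisj hij) hz
    exact (hab j).orient_pos z hzP (fun h => hz' (Or.inl h)) fun h => hz' (Or.inr h)
  left
  rw [AffineMap.apply_lineMap, lineMap_apply_ring']
  nlinarith [mul_pos (sub_pos.2 hc.2) (hpos (Or.inl rfl) (hab i).left_mem),
    mul_pos hc.1 (hpos (Or.inr rfl) (hab i).right_mem)]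

lemma notMem_of_mem_iInter_side {a b : Fin m → Plane} {V : Set Plane} {S : Fin m → Set Plane}
    {z : Plane} (hV : V = Set.range a ∪ Set.range b) (ha : ∀ i, a i ∉ S i) (hb : ∀ i, b i ∉ S i)
    (hz : z ∈ ⋂ i, side (a i) (b i) (S i)) : z ∉ V := by
  rw [Set.mem_iInter] at hz
  subst hV
  rintro (⟨i, rfl⟩ | ⟨i, rfl⟩)
  · exact left_notMem_side (ha i) (hz i)
  · exact right_notMem_side (hb i) (hz i)

/-- Each edge `a i b i` takes care of what lies beyond it, its open segment belongs to the convex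
hull of the edges, and what lies in front of all the edges is left to the other points. -/
theorem isConvexUnion_of_isHullEdge {a b : Fin m → Plane} (hab : ∀ i, IsHullEdge P (a i) (b i))
    (hdisj : Pairwise fun i j => Disjoint ({a i, b i} : Set Plane) {a j, b j})
    {V : Set Plane} (hV : V = Set.range a ∪ Set.range b) (hhull : ↑P ∩ convexHull ℝ V ⊆ V)
    (hk : IsConvexUnion False (↑P \ V)ᶜ k) : IsConvexUnion False (P : Set Plane)ᶜ (m + 1 + k) := by
  let H (i : Fin m) := side (b i) (a i) (outerRay (b i) (a i))
  let M := convexHull ℝ V ∩ ⋂ i, side (a i) (b i) (openSegment ℝ (a i) (b i))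
  let C := ⋂ i, side (a i) (b i) (outerRay (a i) (b i))
  have hne i := (hab i).ne
  have hunion : (⋃ i, H i) ∪ M ∪ (↑P \ V)ᶜ ∩ C = (P : Set Plane)ᶜ := by
    refine Set.Subset.antisymm ?_ fun z hzP => or_iff_not_imp_right.2 fun hzC => ?_
    · rintro z ((hz | ⟨hzV, hz⟩) | ⟨hzPV, hz⟩) hzP
      · obtain ⟨i, hi⟩ := Set.mem_iUnion.1 hz
        exact (hab i).notMem_side (right_notMem_outerRay (hne i).symm)
          (left_notMem_outerRay (hne i).symm) hzP hi
      · exact notMem_of_mem_iInter_side hV (fun i h => hne i (left_mem_openSegment_iff.1 h))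
          (fun i h => hne i (right_mem_openSegment_iff.1 h)) hz (hhull ⟨hzP, hzV⟩)
      · exact hzPV ⟨hzP, notMem_of_mem_iInter_side hV (fun i => left_notMem_outerRay (hne i))
          (fun i => right_notMem_outerRay (hne i)) hz⟩
    · have hzC' : z ∉ C := fun h => hzC ⟨fun h' => hzP h'.1, h⟩
      obtain ⟨i, hi⟩ := not_forall.1 (Set.mem_iInter.not.1 hzC')
      rcases (hab i).mem_side_or_mem_openSegment hzP hi with h | h
      · exact Or.inl (Set.mem_iUnion.2 ⟨i, h⟩)
      have ha : a i ∈ V := hV ▸ Or.inl ⟨i, rfl⟩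
      have hb : b i ∈ V := hV ▸ Or.inr ⟨i, rfl⟩
      exact Or.inr ⟨(convex_convexHull ℝ V).openSegment_subset (subset_convexHull ℝ V ha)
        (subset_convexHull ℝ V hb) h, openSegment_subset_iInter_side hab hdisj i h⟩
  have hH : IsConvexUnion False (⋃ i, H i) m :=
    ⟨H, fun i => convex_side _ _ (convex_outerRay _ _), False.elim, rfl⟩
  have hM : Convex ℝ M := (convex_convexHull ℝ V).inter
    (convex_iInter fun i => convex_side _ _ (convex_openSegment _ _))
  have hC : Convex ℝ C := convex_iInter fun i => convex_side _ _ (convex_outerRay _ _)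
  rw [← hunion]
  exact (hH.union (.of_convex False hM) False.elim).union (hk.inter hC) False.elim

lemma image_Iio_two_mul {α : Type*} (f : ℕ → α) (m : ℕ) : f '' Set.Iio (2 * m) =
    Set.range (fun i : Fin m => f (2 * i)) ∪ Set.range fun i : Fin m => f (2 * i + 1) := by
  ext z
  constructor
  · rintro ⟨i, hi : i < 2 * m, rfl⟩
    obtain ⟨l, rfl | rfl⟩ := Nat.even_or_odd' i
    · exact Or.inl ⟨⟨l, by omega⟩, rfl⟩
    · exact Or.inr ⟨⟨l, by omega⟩, rfl⟩
  · rintro (⟨i, rfl⟩ | ⟨i, rfl⟩)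
    · exact ⟨2 * i, show 2 * (i : ℕ) < 2 * m by omega, rfl⟩
    · exact ⟨2 * i + 1, show 2 * (i : ℕ) + 1 < 2 * m by omega, rfl⟩

lemma inter_convexHull_image_Iio_subset {f : ℕ → Plane} {n : ℕ}
    (hf : Set.BijOn f (Set.Iio P.card) P)
    (hpos : ∀ i j l, i < j → j < l → j < n → l < P.card → 0 < orient (f i) (f j) (f l)) :
    ↑P ∩ convexHull ℝ (f '' Set.Iio n) ⊆ f '' Set.Iio n := by
  obtain rfl | rfl | ⟨n, rfl⟩ : n = 0 ∨ n = 1 ∨ ∃ n', n = n' + 2 := by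
    rcases n with - | - | n <;> simp
  · simp
  · have hIio : Set.Iio 1 = {0} := by ext; simp
    simp [hIio]
  rintro z ⟨hz, hhull⟩
  obtain ⟨l, hl : l < P.card, rfl⟩ := hf.surjOn hz
  refine ⟨l, not_le.1 fun hnl : n + 2 ≤ l => ?_, rfl⟩
  have hsub : f '' Set.Iio (n + 2) ⊆ orient (f 0) (f (n + 1)) ⁻¹' Set.Iic 0 := by
    rintro _ ⟨i, hi : i < n + 2, rfl⟩
    obtain rfl | rfl | ⟨h0, hin⟩ : i = 0 ∨ i = n + 1 ∨ 0 < i ∧ i < n + 1 := by omega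
    · simp
    · simp
    · have := hpos 0 i (n + 1) h0 hin hi (by omega)
      rw [orient_swap_right] at this
      exact neg_nonneg.1 this.le
  have hle : orient (f 0) (f (n + 1)) (f l) ≤ 0 :=
    convexHull_min hsub ((convex_Iic 0).affine_preimage _) hhull
  exact hle.not_gt (hpos 0 (n + 1) l n.succ_pos (by omega) (by omega) hl)

/-- Every second side of the polygon spanned by the first `2 * m` points is used as an edge. -/
theorem isConvexUnion_of_ccw_prefix {f : ℕ → Plane} (hf : Set.BijOn f (Set.Iio P.card) P)
    (hm : 2 * m ≤ P.card)
    (hpos : ∀ i j l, i < j → j < l → j < 2 * m → l < P.card → 0 < orient (f i) (f j) (f l))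
    (hk : IsConvexUnion False (f '' Set.Ico (2 * m) P.card)ᶜ k) :
    IsConvexUnion False (P : Set Plane)ᶜ (m + 1 + k) := by
  have hmem {i : ℕ} (hi : i < P.card) : f i ∈ P := hf.mapsTo hi
  have hne {i j : ℕ} (hi : i < P.card) (hj : j < P.card) (hij : i ≠ j) : f i ≠ f j :=
    hf.injOn.ne hi hj hij
  have hedge (i : Fin m) : IsHullEdge P (f (2 * i)) (f (2 * i + 1)) := by
    refine ⟨hmem (by omega), hmem (by omega), hne (by omega) (by omega) (by omega), ?_⟩
    intro z hz hza hzb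
    obtain ⟨l, hl, rfl⟩ := hf.surjOn hz
    obtain h | rfl | rfl | h : l < 2 * i ∨ l = 2 * i ∨ l = 2 * i + 1 ∨ 2 * i + 1 < l := by omega
    · rw [orient_rotate]
      exact hpos _ _ _ h (by omega) (by omega) (by omega)
    · exact absurd rfl hza
    · exact absurd rfl hzb
    · exact hpos _ _ _ (by omega) h (by omega) hl
  have hrest : (P : Set Plane) \ f '' Set.Iio (2 * m) = f '' Set.Ico (2 * m) P.card := by
    rw [← hf.image_eq, ← hf.injOn.image_sdiff_subset (Set.Iio_subset_Iio hm)]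
    congr 1
    ext i
    simp
  refine isConvexUnion_of_isHullEdge hedge (fun i j hij => ?_) (image_Iio_two_mul f m)
    (inter_convexHull_image_Iio_subset hf hpos) (hrest ▸ hk)
  have hij' := Fin.val_ne_of_ne hij
  simp only [Set.disjoint_insert_left, Set.disjoint_singleton_left, Set.mem_insert_iff,
    Set.mem_singleton_iff, not_or]
  refine ⟨⟨?_, ?_⟩, ?_, ?_⟩ <;> exact hne (by omega) (by omega) (by omega)

end Matching

/-! ### The upper bound for convex position -/

section ConvexBound

variable {P : Finset Plane}

lemma orient_smul_add_orient_smul_add_orient_smul (a b c z : Plane) :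
    orient b c z • a + orient c a z • b + orient a b z • c = orient a b c • z := by
  ext i
  fin_cases i <;> simp only [orient_apply, Fin.zero_eta, Fin.mk_one, PiLp.add_apply,
    PiLp.smul_apply, smul_eq_mul] <;> ring

lemma mem_of_smul_eq_smul_add_smul_add_smul {E : Type*} [AddCommGroup E] [Module ℝ E] {K : Set E}
    (hK : Convex ℝ K) {x y z w : E} (hx : x ∈ K) (hy : y ∈ K) (hz : z ∈ K) {a b c : ℝ}
    (ha : 0 ≤ a) (hb : 0 ≤ b) (hc : 0 ≤ c) (hpos : 0 < a + b + c)
    (h : (a + b + c) • w = a • x + b • y + c • z) : w ∈ K := by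
  have hmem := hK.sum_mem (t := Finset.univ)
    (w := ![a / (a + b + c), b / (a + b + c), c / (a + b + c)]) (z := ![x, y, z])
    (by simp [Fin.forall_fin_succ, div_nonneg, *, hpos.le])
    (by simp [Fin.sum_univ_three, ← add_div, hpos.ne']) (by simp [Fin.forall_fin_succ, *])
  rw [← inv_smul_smul₀ hpos.ne' w, h]
  simpa [Fin.sum_univ_three, smul_smul, div_eq_inv_mul] using hmem

lemma mem_convexHull_of_orient_nonneg {S : Set Plane} {a b c z : Plane} (ha : a ∈ S) (hb : b ∈ S)
    (hc : c ∈ S) (habc : 0 < orient a b c) (hbcz : 0 ≤ orient b c z) (hcaz : 0 ≤ orient c a z)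
    (habz : 0 ≤ orient a b z) : z ∈ convexHull ℝ S := by
  have hsub := subset_convexHull ℝ S
  refine mem_of_smul_eq_smul_add_smul_add_smul (convex_convexHull ℝ S) (hsub ha) (hsub hb)
    (hsub hc) hbcz hcaz habz ?_ ?_ <;> rw [orient_add_orient_add_orient]
  · exact habc
  · exact (orient_smul_add_orient_smul_add_orient_smul a b c z).symm

lemma orient_pos_of_notMem_convexHull {S : Set Plane} {v x y z : Plane} (hv : v ∈ S) (hx : x ∈ S)
    (hz : z ∈ S) (hxy : 0 < orient v x y) (hyz : 0 < orient v y z) (hxz : 0 < orient v x z)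
    (hhull : y ∉ convexHull ℝ (S \ {y})) : 0 < orient x y z := by
  have hxyne : x ≠ y := by rintro rfl; simp at hxy
  have hyzne : y ≠ z := by rintro rfl; simp at hyz
  have hvyne : v ≠ y := by rintro rfl; simp at hxy
  by_contra! hcon
  refine hhull (mem_convexHull_of_orient_nonneg (a := v) (b := x) (c := z) ⟨hv, hvyne⟩
    ⟨hx, hxyne⟩ ⟨hz, hyzne.symm⟩ hxz ?_ ?_ hxy.le)
  · rw [orient_swap_right]
    exact neg_nonneg.2 hcon
  · rw [← orient_rotate]
    exact hyz.le

lemma ConvexPosition.exists_bijOn_orient_pos (hP : ConvexPosition P) :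
    ∃ f : ℕ → Plane, Set.BijOn f (Set.Iio P.card) P ∧
      ∀ i j k, i < j → j < k → k < P.card → 0 < orient (f i) (f j) (f k) := by
  obtain ⟨f, hf, hpos⟩ := hP.generalPosition.exists_bijOn_orient_pos
  refine ⟨f, hf, fun i j k hij hjk hk => ?_⟩
  rcases Nat.eq_zero_or_pos i with rfl | hi
  · exact hpos j k hij hjk hk
  have hmem {l : ℕ} (hl : l < P.card) : f l ∈ P := hf.mapsTo hl
  exact orient_pos_of_notMem_convexHull (hmem (l := 0) (by omega)) (hmem (by omega)) (hmem hk)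
    (hpos i j hi hij (by omega)) (hpos j k (by omega) hjk hk) (hpos i k hi (by omega) hk)
    (hP.notMem_convexHull (hmem (by omega)))

theorem ConvexPosition.isConvexUnion_convexBound (hP : ConvexPosition P) :
    IsConvexUnion False (P : Set Plane)ᶜ (convexBound P.card) := by
  classical
  by_cases hsmall : P.card = 0 ∨ P.card = 1 ∨ P.card = 3
  · refine (hP.generalPosition.isConvexUnion_disjointBound False).mono ?_
    unfold disjointBound convexBound delta
    rcases hsmall with h | h | h <;> simp [h]
  obtain ⟨f, hf, hpos⟩ := hP.exists_bijOn_orient_pos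
  let Q := (Finset.Ico (2 * (P.card / 2)) P.card).image f
  have hQ : Q.card ≤ P.card - 2 * (P.card / 2) := Finset.card_image_le.trans (by simp)
  have hrest : IsConvexUnion False (f '' Set.Ico (2 * (P.card / 2)) P.card)ᶜ (Q.card + 1) := by
    simpa [Q] using isConvexUnion_compl_of_card_le_two (P := Q) (d := False) (by omega)
  refine (isConvexUnion_of_ccw_prefix hf (by omega)
    (fun i j l hij hjl _ hl => hpos i j l hij hjl hl) hrest).mono ?_
  unfold convexBound delta
  rw [if_neg hsmall]
  omega

end ConvexBound

/-! ### Rotating a line around a point -/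

section Sweep

/-- A discrete intermediate value property: as `t y` grows, each `z` with `0 < h z` enters the count
once and each `z` with `h z < 0` leaves it once. -/
lemma exists_card_filter_mul_sub_pos_eq {α : Type*} {Z : Finset α} {t : α → ℝ}
    (ht : Set.InjOn t Z) {h : α → ℝ} {k : ℕ} (hneg : (Z.filter (h · < 0)).card ≤ k)
    (hpos : k + 1 ≤ (Z.filter (0 < h ·)).card) :
    ∃ y ∈ Z, (Z.filter fun z => 0 < h z * (t y - t z)).card = k := by
  classical
  induction Z using Finset.induction_on_min_value t generalizing k with
  | empty => simp at hpos
  | insert a s ha hmin ih =>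
    have hlt {y : α} (hy : y ∈ s) : t a < t y := lt_of_le_of_ne (hmin y hy) fun h =>
      ha (ht (Finset.mem_insert_self a s) (Finset.mem_insert_of_mem hy) h ▸ hy)
    have hs : Set.InjOn t s := ht.mono (Finset.coe_subset.2 (Finset.subset_insert a s))
    have hcount {y : α} (hy : y ∈ s) : 0 < h a * (t y - t a) ↔ 0 < h a :=
      mul_pos_iff_of_pos_right (sub_pos.2 (hlt hy))
    rw [Finset.filter_insert] at hpos
    by_cases hapos : 0 < h a
    · rw [if_pos hapos, Finset.card_insert_of_notMem (by simp [ha])] at hpos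
      rw [Finset.filter_insert, if_neg hapos.not_gt] at hneg
      rcases hneg.eq_or_lt with hk | hk
      · refine ⟨a, Finset.mem_insert_self a s, ?_⟩
        rw [Finset.filter_insert, if_neg (by simp), ← hk]
        refine congrArg _ (Finset.filter_congr fun z hz => ?_)
        exact ⟨fun h0 => neg_of_mul_pos_left h0 (sub_neg.2 (hlt hz)).le,
          fun hz0 => mul_pos_of_neg_of_neg hz0 (sub_neg.2 (hlt hz))⟩
      · obtain ⟨y, hy, hcard⟩ := ih hs (k := k - 1) (by omega) (by omega)
        refine ⟨y, Finset.mem_insert_of_mem hy, ?_⟩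
        rw [Finset.filter_insert, if_pos ((hcount hy).2 hapos),
          Finset.card_insert_of_notMem (by simp [ha]), hcard]
        omega
    · rw [if_neg hapos] at hpos
      have hsub := Finset.card_le_card (Finset.filter_subset_filter (h · < 0)
        (Finset.subset_insert a s))
      obtain ⟨y, hy, hcard⟩ := ih hs (hsub.trans hneg) hpos
      refine ⟨y, Finset.mem_insert_of_mem hy, ?_⟩
      rw [Finset.filter_insert, if_neg ((hcount hy).not.2 hapos), hcard]

variable {P : Finset Plane} {v x y z : Plane} {k : ℕ}

lemma mul_orient_pos_iff (hy : orient x v y ≠ 0) (hz : orient x v z ≠ 0) :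
    0 < orient v x y * orient x y z ↔ 0 < orient v x z * (cot x v y - cot x v z) := by
  have hkey : inner ℝ (v - x) (v - x) * (orient v x y * orient x y z) =
      orient v x y * orient v x y * (orient v x z * (cot x v y - cot x v z)) := by
    rw [mul_left_comm, inner_mul_orient_eq_mul_cot_sub_cot hy hz, orient_swap x v, orient_swap x v]
    ring
  have hy' : orient v x y ≠ 0 := by
    rw [orient_swap]
    exact neg_ne_zero.2 hy
  rw [← mul_pos_iff_of_pos_left (inner_sub_self_pos hy), hkey,
    mul_pos_iff_of_pos_left (mul_self_pos.2 hy')]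

namespace GeneralPosition

lemma injOn_cot (hP : GeneralPosition P) (hv : v ∈ P) (hx : x ∈ P) (hvx : v ≠ x) :
    Set.InjOn (cot x v) {z | z ∈ P ∧ z ≠ x ∧ z ≠ v} := by
  rintro y ⟨hy, hyx, hyv⟩ z ⟨hz, hzx, hzv⟩ hyz
  have hxvy := hP.orient_ne_zero hx hv hy hvx.symm hyx.symm hyv.symm
  have hxvz := hP.orient_ne_zero hx hv hz hvx.symm hzx.symm hzv.symm
  by_contra hne
  have h0 := inner_mul_orient_eq_mul_cot_sub_cot hxvy hxvz
  rw [hyz, sub_self, mul_zero] at h0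
  exact hP.orient_ne_zero hx hy hz hyx.symm hzx.symm hne
    ((mul_eq_zero.1 h0).resolve_left (inner_sub_self_pos hxvy).ne')

lemma exists_card_filter_mul_orient_pos_eq (hP : GeneralPosition P) (hv : v ∈ P) (hx : x ∈ P)
    (hvx : v ≠ x) (hcard : 2 * k + 3 ≤ P.card) (hfew : (leftOf P x v).card ≤ k) :
    ∃ y ∈ P, y ≠ x ∧ (P.filter fun z => 0 < orient v x y * orient x y z).card = k + 1 := by
  classical
  let Z := P.filter fun z => z ≠ x ∧ z ≠ v
  have hZ {z : Plane} : z ∈ Z ↔ z ∈ P ∧ z ≠ x ∧ z ≠ v := Finset.mem_filter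
  have hfilter {p : Plane → Prop} [DecidablePred p] (hpx : ¬p x) (hpv : ¬p v) :
      Z.filter p = P.filter p := by
    rw [Finset.filter_filter]
    refine Finset.filter_congr fun z _ => and_iff_right_of_imp fun hz => ?_
    exact ⟨fun h => hpx (h ▸ hz), fun h => hpv (h ▸ hz)⟩
  have hne {z : Plane} (hz : z ∈ Z) : orient x v z ≠ 0 :=
    hP.orient_ne_zero hx hv (hZ.1 hz).1 hvx.symm (hZ.1 hz).2.1.symm (hZ.1 hz).2.2.symm
  have hsum := hP.card_leftOf_add_card_leftOf hv hx hvx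
  obtain ⟨y, hy, hyk⟩ := exists_card_filter_mul_sub_pos_eq (h := orient v x) (k := k)
    ((hP.injOn_cot hv hx hvx).mono fun z hz => hZ.1 hz)
    (by simpa only [hfilter (p := (orient v x · < 0)) (by simp) (by simp), leftOf,
      orient_swap v x, neg_pos] using hfew)
    (by rw [hfilter (by simp) (by simp), ← leftOf]; omega)
  refine ⟨y, (hZ.1 hy).1, (hZ.1 hy).2.1, ?_⟩
  rw [← hyk, ← Finset.card_insert_of_notMem (a := v) (by simp [hZ])]
  congr 1
  ext z
  rw [Finset.mem_filter, Finset.mem_insert, Finset.mem_filter]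
  obtain rfl | hzv := eq_or_ne z v
  · have hzxy : orient z x y ≠ 0 := by rw [orient_swap]; exact neg_ne_zero.2 (hne hy)
    simp [hv, orient_rotate z x y, hzxy]
  obtain rfl | hzx := eq_or_ne z x
  · simp [hvx.symm, hZ]
  have hz : z ∈ P ↔ z ∈ Z := by simp [hZ, hzx, hzv]
  rw [or_iff_right hzv, hz]
  exact and_congr_right fun hz => mul_orient_pos_iff (hne hy) (hne hz)

/-- The line `x y` is found by rotating the line `v x` around `x`. -/
lemma exists_card_leftOf_eq (hP : GeneralPosition P) (hv : v ∈ P) (hx : x ∈ P) (hvx : v ≠ x)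
    (hcard : 2 * k + 3 ≤ P.card) (hfew : (leftOf P x v).card ≤ k) :
    ∃ y ∈ P, y ≠ x ∧ ((leftOf P x y).card = k + 1 ∨ (leftOf P y x).card = k + 1) := by
  obtain ⟨y, hy, hyx, hk⟩ := hP.exists_card_filter_mul_orient_pos_eq hv hx hvx hcard hfew
  refine ⟨y, hy, hyx, ?_⟩
  rcases lt_trichotomy (orient v x y) 0 with h | h | h
  · right
    have hneg (z : Plane) : 0 < orient v x y * orient x y z ↔ 0 < orient y x z := by
      rw [orient_swap x y, ← neg_mul_neg, mul_pos_iff_of_pos_left (neg_pos.2 h)]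
    simpa only [leftOf, hneg] using hk
  · simp [h] at hk
  · left
    simpa only [leftOf, mul_pos_iff_of_pos_left h] using hk

end GeneralPosition

end Sweep

/-! ### A hull edge crossing a given line -/

section Crossing

variable {P : Finset Plane} {x y : Plane}

lemma notMem_convexHull_of_orient_pos {S : Set Plane} {a : Plane} (hax : a ≠ x)
    (h : ∀ z ∈ S, z ≠ a → 0 < orient a x z) : x ∉ convexHull ℝ S := by
  have hsub : S ⊆ side a x {a} := fun z hz => by
    by_cases hza : z = a
    · exact Or.inr ⟨by simp [hza], hza⟩
    · exact Or.inl (h z hz hza)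
  exact fun hx => right_notMem_side (S := {a}) hax.symm
    (convexHull_min hsub (convex_side a x (convex_singleton a)) hx)

lemma GeneralPosition.exists_mem_leftOf_orient_pos (hP : GeneralPosition P) (hx : x ∈ P)
    (hy : y ∈ P) (hxy : x ≠ y) (hhull : x ∈ convexHull ℝ ((P : Set Plane) \ {x})) :
    ∃ a ∈ leftOf P x y, ∃ b ∈ leftOf P y x, 0 < orient x a b := by
  by_contra! hcon
  rcases (leftOf P x y).eq_empty_or_nonempty with hempty | hne
  · refine notMem_convexHull_of_orient_pos hxy.symm (fun z hz hzy => ?_) hhull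
    have hle : ¬0 < orient x y z := fun h =>
      Finset.notMem_empty z (hempty ▸ mem_leftOf.2 ⟨hz.1, h⟩)
    rw [orient_swap]
    exact neg_pos.2 (lt_of_le_of_ne (not_lt.1 hle)
      (hP.orient_ne_zero hx hy hz.1 hxy (Ne.symm hz.2) hzy.symm))
  obtain ⟨a, ha, hmin⟩ := (leftOf P x y).exists_min_image (cot x y) hne
  obtain ⟨haP, hxya⟩ := mem_leftOf.1 ha
  have hax : a ≠ x := by
    rintro rfl
    simp at hxya
  refine notMem_convexHull_of_orient_pos hax (fun z hz hza => ?_) hhull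
  rw [orient_swap]
  refine neg_pos.2 (lt_of_le_of_ne ?_ (hP.orient_ne_zero hx haP hz.1 hax.symm (Ne.symm hz.2)
    hza.symm))
  rcases lt_trichotomy (orient x y z) 0 with h | h | h
  · exact hcon a ha z (mem_leftOf.2 ⟨hz.1, by rwa [orient_swap, neg_pos]⟩)
  · rcases hP.eq_or_eq_of_orient_eq_zero hx hy hz.1 hxy h with rfl | rfl
    · exact absurd rfl hz.2
    · rw [orient_swap_right]
      exact neg_nonpos.2 hxya.le
  · refine not_lt.1 fun hpos => ?_
    exact (hmin z (mem_leftOf.2 ⟨hz.1, h⟩)).not_gt ((orient_pos_iff_cot_lt_cot hxya h).1 hpos)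

lemma orient_mul_orient_apex (x y a b z : Plane) :
    orient x y a * orient a b z =
      orient x a b * (orient x y a - orient x y z) -
        orient x a z * (orient x y a - orient x y b) := by
  simp only [orient_apply]
  ring

/-- Among the segments `a b` that cross the line `x y`, the one maximising the quotient, a multiple
of the signed distance from `x` to the crossing point, is an edge. -/
lemma GeneralPosition.isHullEdge_of_forall_div_le (hP : GeneralPosition P) (hx : x ∈ P)
    (hy : y ∈ P) (hxy : x ≠ y) {a b : Plane} (ha : a ∈ leftOf P x y) (hb : b ∈ leftOf P y x)
    (hab : 0 < orient x a b)
    (hmax : ∀ c ∈ leftOf P x y, ∀ d ∈ leftOf P y x, orient x c d / (orient x y c - orient x y d) ≤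
      orient x a b / (orient x y a - orient x y b)) : IsHullEdge P a b := by
  have hright {d : Plane} : d ∈ leftOf P y x ↔ d ∈ P ∧ orient x y d < 0 := by
    rw [mem_leftOf, orient_swap, neg_pos]
  have haP := mem_leftOf.1 ha
  have hbP := hright.1 hb
  have hne : a ≠ b := by
    rintro rfl
    simp at hab
  refine ⟨haP.1, hbP.1, hne, fun z hz hza hzb => ?_⟩
  have hapex := orient_mul_orient_apex x y a b z
  have hapex' := orient_mul_orient_apex x y b a z
  have habz := hP.orient_ne_zero haP.1 hbP.1 hz hne hza.symm hzb.symm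
  rcases lt_trichotomy (orient x y z) 0 with h | h | h
  · have hle := hmax a ha z (hright.2 ⟨hz, h⟩)
    rw [div_le_div_iff₀ (by linarith) (by linarith), ← sub_nonneg, ← hapex] at hle
    exact lt_of_le_of_ne (nonneg_of_mul_nonneg_right hle haP.2) habz.symm
  · rcases hP.eq_or_eq_of_orient_eq_zero hx hy hz hxy h with rfl | rfl
    · rwa [orient_rotate z a b]
    · have hxaz : orient x a z = -orient x z a := orient_swap_right x z a
      rw [h, hxaz] at hapex
      refine (mul_pos_iff_of_pos_left haP.2).1 (hapex ▸ ?_)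
      nlinarith [mul_pos hab haP.2, mul_pos haP.2 haP.2, mul_neg_of_pos_of_neg haP.2 hbP.2]
  · have hle := hmax z (mem_leftOf.2 ⟨hz, h⟩) b hb
    rw [div_le_div_iff₀ (by linarith) (by linarith)] at hle
    rw [orient_swap a b, orient_swap_right x a b, orient_swap_right x z b] at hapex'
    exact lt_of_le_of_ne (nonneg_of_mul_nonneg_right (a := -orient x y b) (by linarith)
      (neg_pos.2 hbP.2)) habz.symm

lemma GeneralPosition.exists_isHullEdge_crossing (hP : GeneralPosition P) (hx : x ∈ P)
    (hy : y ∈ P) (hxy : x ≠ y) (hhull : x ∈ convexHull ℝ ((P : Set Plane) \ {x})) :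
    ∃ a ∈ leftOf P x y, ∃ b ∈ leftOf P y x, IsHullEdge P a b := by
  obtain ⟨a₀, ha₀, b₀, hb₀, hpos⟩ := hP.exists_mem_leftOf_orient_pos hx hy hxy hhull
  have hden {c d : Plane} (hc : c ∈ leftOf P x y) (hd : d ∈ leftOf P y x) :
      0 < orient x y c - orient x y d := by
    linarith [(mem_leftOf.1 hc).2, (mem_leftOf.1 hd).2, orient_swap x y d]
  obtain ⟨⟨a, b⟩, hab, hmax⟩ := (leftOf P x y ×ˢ leftOf P y x).exists_max_image
    (fun p => orient x p.1 p.2 / (orient x y p.1 - orient x y p.2))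
    ⟨(a₀, b₀), Finset.mem_product.2 ⟨ha₀, hb₀⟩⟩
  obtain ⟨ha, hb⟩ := Finset.mem_product.1 hab
  have hmax' {c d : Plane} (hc : c ∈ leftOf P x y) (hd : d ∈ leftOf P y x) :=
    hmax (c, d) (Finset.mem_product.2 ⟨hc, hd⟩)
  refine ⟨a, ha, b, hb, hP.isHullEdge_of_forall_div_le hx hy hxy ha hb ?_
    fun c hc d hd => hmax' hc hd⟩
  exact (div_pos_iff_of_pos_right (hden ha hb)).1
    ((div_pos hpos (hden ha₀ hb₀)).trans_le (hmax' ha₀ hb₀))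

end Crossing

section EdgeAndLine

variable {P : Finset Plane} {p q x y z : Plane} {m k : ℕ}

lemma max_lt_or_lt_min_of_mem_outerRay {f : Plane →ᵃ[ℝ] ℝ} (hpq : f p ≠ f q)
    (hz : z ∈ outerRay p q) : max (f p) (f q) < f z ∨ f z < min (f p) (f q) := by
  rcases hpq.lt_or_gt with h | h
  · have := lt_of_mem_outerRay (f := -f) (neg_lt_neg h) hz
    exact Or.inr (lt_min (neg_lt_neg_iff.1 this) ((neg_lt_neg_iff.1 this).trans h))
  · have := lt_of_mem_outerRay h hz
    exact Or.inl (max_lt this (h.trans this))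

lemma IsHullEdge.max_lt_or_lt_min (h : IsHullEdge P p q) {f : Plane →ᵃ[ℝ] ℝ} (hf : f p ≠ f q)
    (hz : z ∉ P) (h0 : orient p q z = 0) (hseg : z ∉ openSegment ℝ p q) :
    max (f p) (f q) < f z ∨ f z < min (f p) (f q) := by
  rcases line_cases h.ne h0 with h' | rfl | h' | rfl | h'
  · exact max_lt_or_lt_min_of_mem_outerRay hf h'
  · exact absurd h.left_mem hz
  · exact absurd h' hseg
  · exact absurd h.right_mem hz
  · rw [max_comm, min_comm]
    exact max_lt_or_lt_min_of_mem_outerRay hf.symm h'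

/-- On either side of a dividing line, the part of the line `p q` that is not beyond the edge is cut
out by a half-plane. -/
lemma IsHullEdge.compl_eq_union (h : IsHullEdge P p q) {f : Plane →ᵃ[ℝ] ℝ} (hf : f p ≠ f q)
    {R : Set Plane} (hR : f ⁻¹' Set.Ioi (max (f p) (f q)) ⊆ R)
    (hRc : f ⁻¹' Set.Iio (min (f p) (f q)) ⊆ Rᶜ) :
    (P : Set Plane)ᶜ = side q p (openSegment ℝ p q) ∪
      ((↑(P \ {p, q}) : Set Plane)ᶜ ∩ R ∩ side p q (f ⁻¹' Set.Ioi (max (f p) (f q))) ∪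
        (↑(P \ {p, q}) : Set Plane)ᶜ ∩ Rᶜ ∩ side p q (f ⁻¹' Set.Iio (min (f p) (f q)))) := by
  refine Set.Subset.antisymm (fun z hz => or_iff_not_imp_left.2 fun hzH => ?_) ?_
  · have hz' : z ∉ P \ {p, q} := fun h => hz (Finset.mem_sdiff.1 h).1
    rw [← Set.mem_compl_iff, compl_side] at hzH
    rcases hzH with hpos | ⟨h0, hseg⟩
    · by_cases hzR : z ∈ R
      · exact Or.inl ⟨⟨hz', hzR⟩, Or.inl hpos⟩
      · exact Or.inr ⟨⟨hz', hzR⟩, Or.inl hpos⟩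
    · rcases h.max_lt_or_lt_min hf hz h0 hseg with hlt | hlt
      · exact Or.inl ⟨⟨hz', hR hlt⟩, Or.inr ⟨h0, hlt⟩⟩
      · exact Or.inr ⟨⟨hz', hRc hlt⟩, Or.inr ⟨h0, hlt⟩⟩
  · have hside {z : Plane} {S : Set Plane} (hp : p ∉ S) (hq : q ∉ S) (hz : z ∉ P \ {p, q})
        (hzS : z ∈ side p q S) : z ∉ P := fun hzP => hz <| by
      simp only [Finset.mem_sdiff, Finset.mem_insert, Finset.mem_singleton, not_or]
      exact ⟨hzP, fun h => left_notMem_side hp (h ▸ hzS), fun h => right_notMem_side hq (h ▸ hzS)⟩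
    rintro z (hz | ⟨⟨hz, -⟩, hzS⟩ | ⟨⟨hz, -⟩, hzS⟩) hzP
    · exact h.notMem_side (fun h' => h.ne (left_mem_openSegment_iff.1 h'))
        (fun h' => h.ne (right_mem_openSegment_iff.1 h')) hzP hz
    · exact hside (by simp) (by simp) hz hzS hzP
    · exact hside (by simp) (by simp) hz hzS hzP

theorem GeneralPosition.isConvexUnion_of_crossing (hP : GeneralPosition P) (hpq : IsHullEdge P p q)
    (hcross : orient x y p * orient x y q < 0) (hx : x ∈ P \ {p, q}) (hy : y ∈ P \ {p, q})
    (hxy : x ≠ y) (hne : (leftOf (P \ {p, q}) x y).Nonempty)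
    (hm : ∀ e ∈ leftOf (P \ {p, q}) x y,
      IsConvexUnion False ((leftOf (P \ {p, q}) x y).erase e : Set Plane)ᶜ m)
    (hk : IsConvexUnion False (leftOf (P \ {p, q}) y x : Set Plane)ᶜ k) :
    IsConvexUnion False (P : Set Plane)ᶜ (1 + (m + 1 + k)) := by
  have hP' : GeneralPosition (P \ {p, q}) := hP.mono Finset.sdiff_subset
  have hmax : 0 < max (orient x y p) (orient x y q) := by
    rw [lt_max_iff]
    by_contra! h
    exact hcross.not_ge (mul_nonneg_of_nonpos_of_nonpos h.1 h.2)
  have hmin : min (orient x y p) (orient x y q) < 0 := by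
    rw [min_lt_iff]
    by_contra! h
    exact hcross.not_ge (mul_nonneg h.1 h.2)
  rw [hpq.compl_eq_union (f := orient x y) (R := side x y (openSegment ℝ x y)ᶜ)
    (fun h => hcross.not_ge (h ▸ mul_self_nonneg _)) (fun z hz => Or.inl (hmax.trans hz))
    fun z hz h => h.elim (hmin.trans' hz).not_gt fun h => (hmin.trans' hz).ne h.1]
  refine (IsConvexUnion.of_convex _ (convex_side q p (convex_openSegment p q))).union
    (IsConvexUnion.union ?_ ?_ False.elim) False.elim
  · exact (hP'.isConvexUnion_leftRegion hx hy hxy hne hm).inter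
      (convex_side p q ((convex_Ioi _).affine_preimage _))
  · exact (hP'.isConvexUnion_rightRegion hx hy hxy hk).inter
      (convex_side p q ((convex_Iio _).affine_preimage _))

end EdgeAndLine

/-! ### The bound `7 n / 11 + 4` -/

section SevenElevenths

variable {P : Finset Plane} {a b x y : Plane} {k l : ℕ}

lemma card_leftOf_sdiff_pair (ha : a ∈ P) (hb : b ∈ P) (hcross : orient x y a * orient x y b < 0) :
    (leftOf (P \ {a, b}) x y).card + 1 = (leftOf P x y).card := by
  wlog h : 0 < orient x y a generalizing a b
  · rw [Finset.pair_comm]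
    exact this hb ha (by rwa [mul_comm]) (pos_of_mul_neg_right hcross (not_lt.1 h))
  have herase : leftOf (P \ {a, b}) x y = (leftOf P x y).erase a := by
    ext z
    simp only [mem_leftOf, Finset.mem_sdiff, Finset.mem_insert, Finset.mem_singleton,
      Finset.mem_erase]
    have hbz : 0 < orient x y z → z ≠ b := by
      rintro hz rfl
      exact hcross.not_ge (mul_pos h hz).le
    tauto
  rw [herase, Finset.card_erase_add_one (mem_leftOf.2 ⟨ha, h⟩)]

lemma GeneralPosition.isConvexUnion_of_card_leftOf_eq (hP : GeneralPosition P)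
    (hab : IsHullEdge P a b) (hcross : orient x y a * orient x y b < 0) (hx : x ∈ P) (hy : y ∈ P)
    (hxy : x ≠ y) (hl : (leftOf P x y).card = l + 2)
    (hk : ∀ R ⊆ P, R.card + (l + 5) = P.card → IsConvexUnion False (R : Set Plane)ᶜ k) :
    IsConvexUnion False (P : Set Plane)ᶜ (disjointBound l + 2 + k) := by
  have hne {z w : Plane} (hz : orient x y z = 0) (hw : orient x y w ≠ 0) : z ≠ w := by
    rintro rfl
    exact hw hz
  have ha0 := left_ne_zero_of_mul hcross.ne
  have hb0 := right_ne_zero_of_mul hcross.ne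
  have hx' : x ∈ P \ {a, b} := by simp [hx, hne (orient_self_left ..) ha0, hne _ hb0]
  have hy' : y ∈ P \ {a, b} := by simp [hy, hne _ ha0, hne _ hb0]
  have hleft := card_leftOf_sdiff_pair hab.left_mem hab.right_mem hcross
  have hright : (leftOf (P \ {a, b}) y x).card + 1 = (leftOf P y x).card :=
    card_leftOf_sdiff_pair hab.left_mem hab.right_mem (by
      rwa [orient_swap x y, orient_swap x y, neg_mul_neg])
  have hcard := hP.card_leftOf_add_card_leftOf hx hy hxy
  refine (hP.isConvexUnion_of_crossing hab hcross hx' hy' hxy (Finset.card_pos.1 (by omega))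
    (m := disjointBound l) (fun e he => ?_)
    (hk _ ((leftOf_subset ..).trans Finset.sdiff_subset) (by omega))).mono (by omega)
  have hsub : (leftOf (P \ {a, b}) x y).erase e ⊆ P :=
    (Finset.erase_subset _ _).trans ((leftOf_subset ..).trans Finset.sdiff_subset)
  have he' := Finset.card_erase_add_one he
  rw [show l = ((leftOf (P \ {a, b}) x y).erase e).card by omega]
  exact (hP.mono hsub).isConvexUnion_disjointBound False

lemma card_leftOf_le_of_bijOn {f : ℕ → Plane} (hf : Set.BijOn f (Set.Iio P.card) P)
    (hpos : ∀ i j, 0 < i → i < j → j < P.card → 0 < orient (f 0) (f i) (f j)) {i : ℕ}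
    (hi : 0 < i) : (leftOf P (f i) (f 0)).card ≤ i - 1 := by
  have hsub : leftOf P (f i) (f 0) ⊆ (Finset.Ico 1 i).image f := fun z hz => by
    obtain ⟨hz, hleft⟩ := mem_leftOf.1 hz
    obtain ⟨j, hj, rfl⟩ := hf.surjOn hz
    rw [orient_swap] at hleft
    refine Finset.mem_image_of_mem f (Finset.mem_Ico.2 ⟨Nat.pos_of_ne_zero ?_, ?_⟩)
    · rintro rfl
      simp at hleft
    by_contra! hij
    rcases hij.eq_or_lt with rfl | h
    · simp at hleft
    · linarith [hpos i j hi h hj]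
  exact (Finset.card_le_card hsub).trans (Finset.card_image_le.trans (Nat.card_Ico 1 i).le)

lemma isConvexUnion_of_notMem_convexHull {f : ℕ → Plane} {m : ℕ}
    (hf : Set.BijOn f (Set.Iio P.card) P) (hm : 2 * m ≤ P.card)
    (hpos : ∀ i j, 0 < i → i < j → j < P.card → 0 < orient (f 0) (f i) (f j))
    (hhull : ∀ i, 0 < i → i < 2 * m → f i ∉ convexHull ℝ ((P : Set Plane) \ {f i}))
    (hk : ∀ R ⊆ P, R.card + 2 * m = P.card → IsConvexUnion False (R : Set Plane)ᶜ k) :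
    IsConvexUnion False (P : Set Plane)ᶜ (m + 1 + k) := by
  have hmem {i : ℕ} (hi : i < P.card) : f i ∈ P := hf.mapsTo hi
  refine isConvexUnion_of_ccw_prefix hf hm (fun i j l hij hjl hj hl => ?_) ?_
  · rcases Nat.eq_zero_or_pos i with rfl | hi
    · exact hpos j l hij hjl hl
    · exact orient_pos_of_notMem_convexHull (hmem (i := 0) (by omega))
        (hmem (by omega)) (hmem hl) (hpos i j hi hij (by omega))
        (hpos j l (by omega) hjl hl) (hpos i l hi (by omega) hl) (hhull j (by omega) hj)
  · have hinj : Set.InjOn f (Finset.Ico (2 * m) P.card) :=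
      hf.injOn.mono fun i hi => (Finset.mem_Ico.1 hi).2
    have := hk ((Finset.Ico (2 * m) P.card).image f)
      (Finset.image_subset_iff.2 fun i hi => hmem (Finset.mem_Ico.1 hi).2)
      (by rw [Finset.card_image_of_injOn hinj, Nat.card_Ico]; omega)
    rwa [Finset.coe_image, Finset.coe_Ico] at this

/-- Either the first seven points of a radial enumeration around a hull vertex are hull vertices
themselves, or some line through one of them has eight points on one side and meets a hull edge. -/
theorem GeneralPosition.isConvexUnion_sevenElevenths (hP : GeneralPosition P) :
    IsConvexUnion False (P : Set Plane)ᶜ ((7 * P.card + 44) / 11) := by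
  induction hn : P.card using Nat.strong_induction_on generalizing P with
  | _ n ih =>
  subst hn
  have hrest {R : Finset Plane} {c : ℕ} (hc : 0 < c) (hR : R ⊆ P) (h : R.card + c = P.card) :
      IsConvexUnion False (R : Set Plane)ᶜ ((7 * (P.card - c) + 44) / 11) := by
    rw [show P.card - c = R.card by omega]
    exact ih R.card (by omega) (hP.mono hR) rfl
  rcases lt_or_ge P.card 39 with hsmall | hlarge
  · refine (hP.isConvexUnion_disjointBound False).mono ?_
    unfold disjointBound
    omega
  obtain ⟨f, hf, hpos⟩ := hP.exists_bijOn_orient_pos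
  by_cases hhull : ∀ i, 0 < i → i < 2 * 4 → f i ∉ convexHull ℝ ((P : Set Plane) \ {f i})
  · exact (isConvexUnion_of_notMem_convexHull hf (by omega) hpos hhull
      fun R => hrest (by norm_num)).mono (by omega)
  push Not at hhull
  obtain ⟨i, hi, hi8, hhull⟩ := hhull
  have hx : f i ∈ P := hf.mapsTo (show i < P.card by omega)
  have hv : f 0 ∈ P := hf.mapsTo (show 0 < P.card by omega)
  have hvx : f 0 ≠ f i :=
    hf.injOn.ne (show 0 < P.card by omega) (show i < P.card by omega) hi.ne
  obtain ⟨y, hy, hyx, h8⟩ := hP.exists_card_leftOf_eq (k := 7) hv hx hvx (by omega)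
    ((card_leftOf_le_of_bijOn hf hpos hi).trans (by omega))
  obtain ⟨a, ha, b, hb, hab⟩ := hP.exists_isHullEdge_crossing hx hy hyx.symm hhull
  have hcross : 0 < orient (f i) y a * orient y (f i) b :=
    mul_pos (mem_leftOf.1 ha).2 (mem_leftOf.1 hb).2
  have hcost : disjointBound 6 + 2 + (7 * (P.card - 11) + 44) / 11 ≤ (7 * P.card + 44) / 11 := by
    unfold disjointBound
    omega
  rcases h8 with h8 | h8
  · refine (hP.isConvexUnion_of_card_leftOf_eq hab ?_ hx hy hyx.symm h8
      fun R => hrest (by norm_num)).mono hcost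
    rwa [orient_swap y (f i) b, mul_neg, neg_lt_zero]
  · refine (hP.isConvexUnion_of_card_leftOf_eq hab ?_ hy hx hyx h8
      fun R => hrest (by norm_num)).mono hcost
    rwa [orient_swap (f i) y a, neg_mul, neg_lt_zero]

end SevenElevenths

/-! ### Non-crossing colourings -/

section NonCrossing

variable {ι α : Type*} [LinearOrder ι] [DecidableEq α] {E F S : Finset ι} {T : Finset α}
  {col : ι → Finset α} {u v w j : α} {p x y : ι}

/-- An assignment `col` of sets of colours to the elements of `E` in which two colours never
alternate; each element has two colours and two elements together have three. It describes which
convex sets come close to which points of a set in convex position. -/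
structure NonCrossing (E : Finset ι) (col : ι → Finset α) : Prop where
  eq_of_lt {a b c d : ι} {u v : α} : a ∈ E → b ∈ E → c ∈ E → d ∈ E → a < b → b < c → c < d →
    u ∈ col a → u ∈ col c → v ∈ col b → v ∈ col d → u = v
  two_le_card {p : ι} : p ∈ E → 2 ≤ (col p).card
  three_le_card {p q : ι} : p ∈ E → q ∈ E → p ≠ q → 3 ≤ (col p ∪ col q).card

/-- The elements of `E` strictly between two elements of colour `u`. A colour `u` is *wide* if there
are such elements. -/
def between (E : Finset ι) (col : ι → Finset α) (u : α) : Finset ι :=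
  {x ∈ E | (∃ a ∈ E, a < x ∧ u ∈ col a) ∧ ∃ b ∈ E, x < b ∧ u ∈ col b}

lemma mem_between : x ∈ between E col u ↔
    x ∈ E ∧ (∃ a ∈ E, a < x ∧ u ∈ col a) ∧ ∃ b ∈ E, x < b ∧ u ∈ col b :=
  Finset.mem_filter

lemma exists_subset_insert_insert_between (hp : p ∈ E) (hu : u ∈ col p) :
    ∃ a ∈ E, ∃ b ∈ E, u ∈ col a ∧ u ∈ col b ∧
      E.filter (fun q => a ≤ q ∧ q ≤ b) ⊆ insert a (insert b (between E col u)) ∧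
      ∀ q ∈ E, u ∈ col q → a ≤ q ∧ q ≤ b := by
  have hne : (E.filter (u ∈ col ·)).Nonempty := ⟨p, Finset.mem_filter.2 ⟨hp, hu⟩⟩
  obtain ⟨ha, hua⟩ := Finset.mem_filter.1 (Finset.min'_mem _ hne)
  obtain ⟨hb, hub⟩ := Finset.mem_filter.1 (Finset.max'_mem _ hne)
  refine ⟨_, ha, _, hb, hua, hub, fun q hq => ?_, fun q hq huq =>
    ⟨Finset.min'_le _ _ (Finset.mem_filter.2 ⟨hq, huq⟩),
      Finset.le_max' _ _ (Finset.mem_filter.2 ⟨hq, huq⟩)⟩⟩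
  obtain ⟨hq, haq, hqb⟩ := Finset.mem_filter.1 hq
  rw [Finset.mem_insert, Finset.mem_insert, or_iff_not_imp_left, or_iff_not_imp_left]
  exact fun hqa hqb' => mem_between.2
    ⟨hq, ⟨_, ha, lt_of_le_of_ne haq (Ne.symm hqa), hua⟩, _, hb, lt_of_le_of_ne hqb hqb', hub⟩

lemma card_filter_mem_le_two (hu : between E col u = ∅) :
    (E.filter (u ∈ col ·)).card ≤ 2 := by
  rcases (E.filter (u ∈ col ·)).eq_empty_or_nonempty with hempty | ⟨p, hp⟩
  · simp [hempty]
  obtain ⟨hp, hup⟩ := Finset.mem_filter.1 hp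
  obtain ⟨a, -, b, -, -, -, hsub, hab⟩ := exists_subset_insert_insert_between hp hup
  refine (Finset.card_le_card (t := {a, b}) fun q hq => ?_).trans Finset.card_le_two
  obtain ⟨hq, huq⟩ := Finset.mem_filter.1 hq
  simpa [hu] using hsub (Finset.mem_filter.2 ⟨hq, hab q hq huq⟩)

/-- Colours that are concentrated on few elements can be removed with them. -/
lemma two_mul_card_add_three_le_of_sdiff (hS : S ⊆ E) (hT : T ⊆ E.biUnion col)
    (hST : ∀ p ∈ E, ∀ u ∈ T, u ∈ col p → p ∈ S) (hcard : 2 * S.card ≤ 3 * T.card)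
    (ih : 2 * (E \ S).card + 3 ≤ 3 * ((E \ S).biUnion col).card) :
    2 * E.card + 3 ≤ 3 * (E.biUnion col).card := by
  have hsub : (E \ S).biUnion col ⊆ E.biUnion col \ T := fun u hu => by
    obtain ⟨p, hp, hup⟩ := Finset.mem_biUnion.1 hu
    obtain ⟨hpE, hpS⟩ := Finset.mem_sdiff.1 hp
    exact Finset.mem_sdiff.2 ⟨Finset.mem_biUnion.2 ⟨p, hpE, hup⟩, fun h => hpS (hST p hpE u h hup)⟩
  have := Finset.card_le_card hsub
  have := Finset.card_sdiff_add_card_eq_card hS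
  have := Finset.card_sdiff_add_card_eq_card hT
  omega

namespace NonCrossing

lemma mono (h : NonCrossing E col) (hS : S ⊆ E) : NonCrossing S col where
  eq_of_lt ha hb hc hd := h.eq_of_lt (hS ha) (hS hb) (hS hc) (hS hd)
  two_le_card hp := h.two_le_card (hS hp)
  three_le_card hp hq := h.three_le_card (hS hp) (hS hq)

lemma two_mul_card_add_three_le_of_card_le_three (h : NonCrossing E col) (hne : E.Nonempty)
    (hE : E.card ≤ 3) : 2 * E.card + 3 ≤ 3 * (E.biUnion col).card := by
  have hsub {p : ι} (hp : p ∈ E) : col p ⊆ E.biUnion col := Finset.subset_biUnion_of_mem col hp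
  rcases hne.exists_eq_singleton_or_nontrivial with ⟨p, rfl⟩ | ⟨p, hp, q, hq, hpq⟩
  · have := h.two_le_card (Finset.mem_singleton_self p)
    rw [Finset.card_singleton, Finset.singleton_biUnion]
    omega
  · have := (h.three_le_card hp hq hpq).trans
      (Finset.card_le_card (Finset.union_subset (hsub hp) (hsub hq)))
    omega

lemma two_mul_card_add_three_le_of_between_eq_empty (h : NonCrossing E col) (hp : p ∈ E)
    (hu : u ∈ col p) (hv : v ∈ col p) (huv : u ≠ v) (hu' : between E col u = ∅)
    (hv' : between E col v = ∅)
    (ih : ∀ S ⊂ E, S.Nonempty → 2 * S.card + 3 ≤ 3 * (S.biUnion col).card) :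
    2 * E.card + 3 ≤ 3 * (E.biUnion col).card := by
  let S := E.filter (u ∈ col ·) ∪ E.filter (v ∈ col ·)
  have hS : S ⊆ E := Finset.union_subset (Finset.filter_subset _ _) (Finset.filter_subset _ _)
  have hScard : S.card ≤ 3 := by
    have hinter : 0 < (E.filter (u ∈ col ·) ∩ E.filter (v ∈ col ·)).card :=
      Finset.card_pos.2 ⟨p, by simp [hp, hu, hv]⟩
    have := Finset.card_union_add_card_inter (E.filter (u ∈ col ·)) (E.filter (v ∈ col ·))
    have := card_filter_mem_le_two hu'
    have := card_filter_mem_le_two hv'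
    change (E.filter (u ∈ col ·) ∪ E.filter (v ∈ col ·)).card ≤ 3
    omega
  rcases (E \ S).eq_empty_or_nonempty with hempty | hne
  · exact h.two_mul_card_add_three_le_of_card_le_three ⟨p, hp⟩
      ((Finset.card_le_card (Finset.sdiff_eq_empty_iff_subset.1 hempty)).trans hScard)
  refine two_mul_card_add_three_le_of_sdiff (S := S) (T := {u, v}) hS ?_ ?_ ?_
    (ih _ (Finset.sdiff_ssubset hS ⟨p, ?_⟩) hne)
  · simp only [Finset.insert_subset_iff, Finset.singleton_subset_iff, Finset.mem_biUnion]
    exact ⟨⟨p, hp, hu⟩, p, hp, hv⟩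
  · rintro q hq w hw hwq
    rcases Finset.mem_insert.1 hw with rfl | hw
    · simp [S, hq, hwq]
    · simp [S, hq, Finset.mem_singleton.1 hw ▸ hwq]
  · rw [Finset.card_pair huv]
    omega
  · simp [S, hp, hu]

lemma exists_between_nonempty (h : NonCrossing E col) (hp : p ∈ E)
    (hnarrow : ∀ u ∈ col p, ∀ v ∈ col p, between E col u = ∅ → between E col v = ∅ → u = v) :
    ∃ u ∈ col p, (between E col u).Nonempty := by
  obtain ⟨u, hu, v, hv, huv⟩ := Finset.one_lt_card.1 (h.two_le_card hp)
  by_contra! hcon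
  exact huv (hnarrow u hu v hv (hcon u hu) (hcon v hv))

/-- If the elements of `F` have no wide colour but `j`, an element outside `F` whose colours all
occur in `F` has the colours `j` and `v` only, and so does an element of `F`. -/
lemma not_subset_biUnion (h : NonCrossing E col)
    (hnarrow : ∀ p ∈ E, ∀ u ∈ col p, ∀ v ∈ col p,
      between E col u = ∅ → between E col v = ∅ → u = v)
    (hF : F ⊆ E) (hj : ∀ x ∈ F, ∀ v ∈ col x, (between E col v).Nonempty → v = j) (hp : p ∈ E)
    (hpF : p ∉ F) : ¬col p ⊆ F.biUnion col := by
  intro hsub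
  have hpj : ∀ v ∈ col p, (between E col v).Nonempty → v = j := fun v hv hwide => by
    obtain ⟨x, hx, hvx⟩ := Finset.mem_biUnion.1 (hsub hv)
    exact hj x hx v hvx hwide
  obtain ⟨v, hv, hvj⟩ := Finset.exists_mem_ne (h.two_le_card hp) j
  have hv0 := Finset.not_nonempty_iff_eq_empty.1 fun hwide => hvj (hpj v hv hwide)
  have hpair {x : ι} (hx : x ∈ E) (hvx : v ∈ col x)
      (hj : ∀ v ∈ col x, (between E col v).Nonempty → v = j) : col x ⊆ {j, v} := fun w hw => by
    rcases (between E col w).eq_empty_or_nonempty with hw0 | hwide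
    · simp [hnarrow x hx w hw v hvx hw0 hv0]
    · simp [hj w hw hwide]
  obtain ⟨x, hx, hvx⟩ := Finset.mem_biUnion.1 (hsub hv)
  have hpx : p ≠ x := fun h => hpF (h ▸ hx)
  have hle := (h.three_le_card hp (hF hx) hpx).trans
    (Finset.card_le_card (Finset.union_subset (hpair hp hv hpj) (hpair (hF hx) hvx (hj x hx))))
  exact absurd (hle.trans Finset.card_le_two) (by norm_num)

lemma card_add_one_le_card_biUnion (h : NonCrossing E col)
    (hnarrow : ∀ p ∈ E, ∀ u ∈ col p, ∀ v ∈ col p,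
      between E col u = ∅ → between E col v = ∅ → u = v)
    (hne : F.Nonempty) (hF : F ⊆ E)
    (hj : ∀ x ∈ F, ∀ v ∈ col x, (between E col v).Nonempty → v = j) :
    F.card + 1 ≤ (F.biUnion col).card := by
  induction hne using Finset.Nonempty.cons_induction with
  | singleton x => simpa using h.two_le_card (hF (Finset.mem_singleton_self x))
  | cons x F hx _ ih =>
    have hsub : F ⊆ Finset.cons x F hx := Finset.subset_cons hx
    have hlt : (F.biUnion col).card < ((Finset.cons x F hx).biUnion col).card := by
      refine Finset.card_lt_card (Finset.ssubset_iff_subset_ne.2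
        ⟨Finset.biUnion_subset_biUnion_of_subset_left col hsub, fun heq => ?_⟩)
      refine h.not_subset_biUnion hnarrow (hsub.trans hF) (fun y hy => hj y (hsub hy))
        (hF (Finset.mem_cons_self x F)) hx ?_
      rw [heq]
      exact Finset.subset_biUnion_of_mem col (Finset.mem_cons_self x F)
    have := ih (hsub.trans hF) fun y hy => hj y (hsub hy)
    rw [Finset.card_cons]
    omega

lemma le_and_le_of_mem_between (h : NonCrossing E col) {a b : ι} (ha : a ∈ E) (hb : b ∈ E)
    (hua : u ∈ col a) (hub : u ∈ col b) (hspan : ∀ q ∈ E, u ∈ col q → a ≤ q ∧ q ≤ b)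
    (hx : x ∈ between E col u) (hv : v ∈ col x) (hy : y ∈ E) (hvy : v ∈ col y) :
    a ≤ y ∧ y ≤ b := by
  obtain ⟨hxE, ⟨a', ha', hax, hua'⟩, b', hb', hxb, hub'⟩ := mem_between.1 hx
  replace hax := (hspan a' ha' hua').1.trans_lt hax
  replace hxb := hxb.trans_le (hspan b' hb' hub').2
  obtain rfl | hvu := eq_or_ne v u
  · exact hspan y hy hvy
  refine ⟨not_lt.1 fun hya => hvu ?_, not_lt.1 fun hby => hvu ?_⟩
  · exact h.eq_of_lt hy ha hxE hb hya hax hxb hvy hv hua hub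
  · exact (h.eq_of_lt ha hxE hb hy hax hxb hby hua hub hv hvy).symm

lemma between_subset (h : NonCrossing E col) (hx : x ∈ between E col u) (hv : v ∈ col x) :
    between E col v ⊆ between E col u := by
  obtain ⟨-, ⟨p, hp, -, hup⟩, -⟩ := mem_between.1 hx
  obtain ⟨a, ha, b, hb, hua, hub, -, hspan⟩ := exists_subset_insert_insert_between hp hup
  intro z hz
  obtain ⟨hz, ⟨p, hp, hpz, hvp⟩, q, hq, hzq, hvq⟩ := mem_between.1 hz
  have hap := (h.le_and_le_of_mem_between ha hb hua hub hspan hx hv hp hvp).1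
  have hqb := (h.le_and_le_of_mem_between ha hb hua hub hspan hx hv hq hvq).2
  exact mem_between.2 ⟨hz, ⟨a, ha, hap.trans_lt hpz, hua⟩, b, hb, hzq.trans_le hqb, hub⟩

lemma eq_of_between_eq (h : NonCrossing E col) (hxy : x ≠ y) (hv : v ∈ col x) (hw : w ∈ col y)
    (hx : x ∈ between E col w) (hy : y ∈ between E col v) : v = w := by
  wlog hlt : x < y generalizing x y v w
  · exact (this hxy.symm hw hv hy hx (lt_of_le_of_ne (not_lt.1 hlt) hxy.symm)).symm
  obtain ⟨hx, ⟨a, ha, hax, hwa⟩, -⟩ := mem_between.1 hx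
  obtain ⟨hy, -, b, hb, hyb, hvb⟩ := mem_between.1 hy
  exact (h.eq_of_lt ha hx hy hb hax hlt hyb hwa hw hv hvb).symm

lemma exists_forall_eq_of_between_eq (h : NonCrossing E col)
    (hnarrow : ∀ p ∈ E, ∀ u ∈ col p, ∀ v ∈ col p,
      between E col u = ∅ → between E col v = ∅ → u = v)
    (heq : ∀ x ∈ F, ∀ v ∈ col x, (between E col v).Nonempty → between E col v = F)
    (hF : F ⊆ E) (hcard : 1 < F.card) :
    ∃ j, ∀ x ∈ F, ∀ v ∈ col x, (between E col v).Nonempty → v = j := by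
  obtain ⟨x, hx, y, hy, hxy⟩ := Finset.one_lt_card.1 hcard
  have hunique {x y : ι} {v w : α} (hx : x ∈ F) (hy : y ∈ F) (hxy : x ≠ y) (hv : v ∈ col x)
      (hw : w ∈ col y) (hvwide : (between E col v).Nonempty)
      (hwwide : (between E col w).Nonempty) : v = w :=
    h.eq_of_between_eq hxy hv hw (heq y hy w hw hwwide ▸ hx) (heq x hx v hv hvwide ▸ hy)
  obtain ⟨j, hj, hjwide⟩ := h.exists_between_nonempty (hF hx) (hnarrow x (hF hx))
  obtain ⟨w, hw, hwwide⟩ := h.exists_between_nonempty (hF hy) (hnarrow y (hF hy))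
  refine ⟨j, fun z hz v hv hvwide => ?_⟩
  obtain rfl | hzx := eq_or_ne z x
  · exact (hunique hz hy hxy hv hw hvwide hwwide).trans
      (hunique hz hy hxy hj hw hjwide hwwide).symm
  · exact hunique hz hx hzx hv hj hvwide hjwide

lemma card_eq_one_or_card_add_one_le (h : NonCrossing E col)
    (hnarrow : ∀ p ∈ E, ∀ u ∈ col p, ∀ v ∈ col p,
      between E col u = ∅ → between E col v = ∅ → u = v)
    (heq : ∀ x ∈ F, ∀ v ∈ col x, (between E col v).Nonempty → between E col v = F)
    (hne : F.Nonempty) (hF : F ⊆ E) (hp : p ∈ E) (hpF : p ∉ F) :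
    F.card = 1 ∧ 2 ≤ (F.biUnion col).card ∨
      F.card + 1 ≤ (F.biUnion col).card ∧ ¬col p ⊆ F.biUnion col := by
  obtain hcard | hcard := (Nat.succ_le_of_lt hne.card_pos).eq_or_lt
  · obtain ⟨x, rfl⟩ := Finset.card_eq_one.1 hcard.symm
    exact Or.inl ⟨hcard.symm, by simpa using h.two_le_card (Finset.singleton_subset_iff.1 hF)⟩
  · obtain ⟨j, hj⟩ := h.exists_forall_eq_of_between_eq hnarrow heq hF hcard
    exact Or.inr ⟨h.card_add_one_le_card_biUnion hnarrow hne hF hj,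
      h.not_subset_biUnion hnarrow hF hj hp hpF⟩

lemma exists_between_card_le (h : NonCrossing E col) (hne : E.Nonempty)
    (hnarrow : ∀ p ∈ E, ∀ u ∈ col p, ∀ v ∈ col p,
      between E col u = ∅ → between E col v = ∅ → u = v) :
    ∃ p ∈ E, ∃ u ∈ col p, (between E col u).Nonempty ∧
      ∀ x ∈ E, ∀ v ∈ col x, (between E col v).Nonempty →
        (between E col u).card ≤ (between E col v).card := by
  obtain ⟨p, hp⟩ := hne
  obtain ⟨u, hu, hwide⟩ := h.exists_between_nonempty hp (hnarrow p hp)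
  obtain ⟨u, hu, hmin⟩ := ((E.biUnion col).filter fun v =>
    (between E col v).Nonempty).exists_min_image (fun v => (between E col v).card)
      ⟨u, Finset.mem_filter.2 ⟨Finset.mem_biUnion.2 ⟨p, hp, hu⟩, hwide⟩⟩
  obtain ⟨hu, hwide⟩ := Finset.mem_filter.1 hu
  obtain ⟨p, hp, hup⟩ := Finset.mem_biUnion.1 hu
  exact ⟨p, hp, u, hup, hwide, fun x hx v hv hvwide =>
    hmin v (Finset.mem_filter.2 ⟨Finset.mem_biUnion.2 ⟨x, hx, hv⟩, hvwide⟩)⟩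

/-- Take a wide colour with the fewest elements strictly between its extreme elements: these
elements share their wide colour and have otherwise private narrow colours. -/
lemma two_mul_card_add_three_le_of_between_nonempty (h : NonCrossing E col) (hne : E.Nonempty)
    (hnarrow : ∀ p ∈ E, ∀ u ∈ col p, ∀ v ∈ col p,
      between E col u = ∅ → between E col v = ∅ → u = v)
    (ih : ∀ S ⊂ E, S.Nonempty → 2 * S.card + 3 ≤ 3 * (S.biUnion col).card) :
    2 * E.card + 3 ≤ 3 * (E.biUnion col).card := by
  obtain ⟨p, hp, u, hup, hwide, hmin⟩ := h.exists_between_card_le hne hnarrow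
  obtain ⟨a, ha, b, hb, hua, hub, hsub, hspan⟩ := exists_subset_insert_insert_between hp hup
  let I := between E col u
  have hI : I ⊆ E := Finset.filter_subset _ _
  have haI : a ∉ I := fun haI => by
    obtain ⟨-, ⟨q, hq, hqa, huq⟩, -⟩ := mem_between.1 haI
    exact hqa.not_ge (hspan q hq huq).1
  have hcases : I.card = 1 ∧ 2 ≤ (I.biUnion col).card ∨
      I.card + 1 ≤ (I.biUnion col).card ∧ ¬col a ⊆ I.biUnion col :=
    h.card_eq_one_or_card_add_one_le hnarrow (fun x hx v hv hvwide =>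
      Finset.eq_of_subset_of_card_le (h.between_subset hx hv) (hmin x (hI hx) v hv hvwide))
      hwide hI ha haI
  have hIpos : 0 < I.card := hwide.card_pos
  let S := insert a (insert b I)
  have hSE : S ⊆ E := Finset.insert_subset ha (Finset.insert_subset hb hI)
  have hScard : S.card ≤ I.card + 2 :=
    (Finset.card_insert_le _ _).trans (Nat.succ_le_succ (Finset.card_insert_le _ _))
  rcases (E \ S).eq_empty_or_nonempty with hempty | hne'
  · have hES := Finset.card_le_card (Finset.sdiff_eq_empty_iff_subset.1 hempty)
    rcases hcases with ⟨hone, -⟩ | ⟨hcard, hnsub⟩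
    · exact h.two_mul_card_add_three_le_of_card_le_three hne (by omega)
    · have hlt : (I.biUnion col).card < (E.biUnion col).card := Finset.card_lt_card
        (Finset.ssubset_iff_subset_ne.2 ⟨Finset.biUnion_subset_biUnion_of_subset_left col hI,
          fun heq => hnsub (heq.symm ▸ Finset.subset_biUnion_of_mem col ha)⟩)
      omega
  refine two_mul_card_add_three_le_of_sdiff hSE
    (Finset.biUnion_subset_biUnion_of_subset_left col hI) (fun q hq v hv hvq => ?_) (by omega)
    (ih _ (Finset.sdiff_ssubset hSE ⟨a, by simp [S]⟩) hne')
  obtain ⟨x, hx, hvx⟩ := Finset.mem_biUnion.1 hv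
  exact hsub (Finset.mem_filter.2
    ⟨hq, h.le_and_le_of_mem_between ha hb hua hub hspan hx hvx hq hvq⟩)

theorem two_mul_card_add_three_le (h : NonCrossing E col) (hne : E.Nonempty) :
    2 * E.card + 3 ≤ 3 * (E.biUnion col).card := by
  induction E using Finset.strongInduction with
  | H E ih =>
  replace ih (S) (hS : S ⊂ E) (hne : S.Nonempty) := ih S hS (h.mono hS.subset) hne
  by_cases hnarrow : ∀ p ∈ E, ∀ u ∈ col p, ∀ v ∈ col p,
      between E col u = ∅ → between E col v = ∅ → u = v
  · exact h.two_mul_card_add_three_le_of_between_nonempty hne hnarrow ih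
  · push Not at hnarrow
    obtain ⟨p, hp, u, hu, v, hv, hu0, hv0, huv⟩ := hnarrow
    exact h.two_mul_card_add_three_le_of_between_eq_empty hp hu hv huv hu0 hv0 ih

end NonCrossing

end NonCrossing

/-! ### Germs of convex sets -/

section HasGerm

variable {E : Type*} [AddCommGroup E] [Module ℝ E] {K : Set E} {o p q r u : E}

/-- The set `K` contains an initial open segment of the ray from `p` in direction `u`. -/
def HasGerm (K : Set E) (p u : E) : Prop :=
  ∀ᶠ ε : ℝ in 𝓝[>] 0, p + ε • u ∈ K

lemma eventually_mem_of_frequently_mem {S : Set ℝ} (hS : S.OrdConnected) {a : ℝ}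
    (h : ∃ᶠ ε in 𝓝[>] a, ε ∈ S) : ∀ᶠ ε in 𝓝[>] a, ε ∈ S := by
  obtain ⟨ε₀, h₀, hε₀⟩ := (h.and_eventually self_mem_nhdsWithin).exists
  filter_upwards [Ioo_mem_nhdsGT hε₀] with ε hε
  obtain ⟨ε₁, h₁, hε₁⟩ := (h.and_eventually (Ioo_mem_nhdsGT hε.1)).exists
  exact hS.out h₁ h₀ ⟨hε₁.2.le, hε.2.le⟩

lemma hasGerm_of_frequently (hK : Convex ℝ K) (h : ∃ᶠ ε : ℝ in 𝓝[>] 0, p + ε • u ∈ K) :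
    HasGerm K p u :=
  eventually_mem_of_frequently_mem ((hK.translate_preimage_right p).linear_preimage
    (LinearMap.toSpanSingleton ℝ E u)).ordConnected h

namespace HasGerm

lemma mem_of_neg (hK : Convex ℝ K) (h : HasGerm K p u) (h' : HasGerm K p (-u)) : p ∈ K := by
  obtain ⟨ε, h, h'⟩ := (h.and h').exists
  convert hK h h' (a := 1 / 2) (b := 1 / 2) (by norm_num) (by norm_num) (by norm_num) using 1
  module

lemma mem_of_outward (hK : Convex ℝ K) (h : HasGerm K p (p - q)) (h' : HasGerm K q (q - p)) :
    p ∈ K := by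
  obtain ⟨ε, ⟨h, h'⟩, hε : 0 < ε⟩ := ((h.and h').and self_mem_nhdsWithin).exists
  convert hK h h' (a := (1 + ε) / (1 + 2 * ε)) (b := ε / (1 + 2 * ε)) (by positivity)
    (by positivity) (by field) using 1
  match_scalars <;> field

lemma mem_of_mem (hK : Convex ℝ K) (ho : o ∈ K) (h : HasGerm K q (q - o)) : q ∈ K := by
  obtain ⟨ε, h, hε : 0 < ε⟩ := (h.and self_mem_nhdsWithin).exists
  convert hK ho h (a := ε / (1 + ε)) (b := 1 / (1 + ε)) (by positivity) (by positivity)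
    (by field) using 1
  match_scalars <;> field

lemma mem_of_parallel (hK : Convex ℝ K) (h : HasGerm K p (q - p)) (h' : HasGerm K q (q - p)) :
    q ∈ K := by
  obtain ⟨ε, ⟨h, h'⟩, hε⟩ := ((h.and h').and (Ioo_mem_nhdsGT one_pos)).exists
  convert hK h h' hε.1.le (sub_nonneg.2 hε.2.le) (add_sub_cancel ε 1) using 1
  module

/-- The weights below are nonnegative near `0` because the coordinate of `q` is added to `1`. -/
lemma mem_of_barycentric (hK : Convex ℝ K) {α β γ : ℝ} (hsum : α + β + γ = 1)
    (ho : o = α • p + β • q + γ • r) (hα : 0 ≤ α) (hγ : 0 ≤ γ) (hp : HasGerm K p (p - o))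
    (hq : HasGerm K q (q - o)) (hr : HasGerm K r (r - o)) : q ∈ K := by
  have hsmall : ∀ᶠ ε : ℝ in 𝓝[>] 0, 0 < 1 + ε * β :=
    ((by fun_prop : Continuous fun ε : ℝ => 1 + ε * β).tendsto 0).mono_left
      nhdsWithin_le_nhds |>.eventually (lt_mem_nhds (by simp))
  obtain ⟨ε, ⟨⟨⟨hp, hq⟩, hr⟩, hβ⟩, hε : 0 < ε⟩ :=
    ((((hp.and hq).and hr).and hsmall).and self_mem_nhdsWithin).exists
  obtain rfl : β = 1 - α - γ := by linarith
  refine mem_of_smul_eq_smul_add_smul_add_smul hK hp hq hr (a := ε * α)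
    (b := 1 + ε * (1 - α - γ)) (c := ε * γ) (by positivity) hβ.le (by positivity) ?_ ?_
  · linarith
  · rw [ho]
    module

end HasGerm

end HasGerm

section Colors

variable {k : ℕ} {K : Fin k → Set Plane} {p q u : Plane}

lemma EncapsulatesPoint.notMem (h : EncapsulatesPoint K p) (i : Fin k) : p ∉ K i := by
  obtain ⟨N, hN, h⟩ := h
  intro hp
  exact (h.subset ⟨Set.mem_iUnion.2 ⟨i, hp⟩, mem_of_mem_nhds hN⟩).2 rfl

lemma EncapsulatesPoint.eventually_mem_iUnion (h : EncapsulatesPoint K p) :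
    ∀ᶠ z in 𝓝[≠] p, z ∈ ⋃ i, K i := by
  obtain ⟨N, hN, h⟩ := h
  filter_upwards [mem_nhdsWithin_of_mem_nhds hN, self_mem_nhdsWithin] with z hz hzp
  exact (h.superset ⟨hz, hzp⟩).1

lemma tendsto_add_smul_nhdsGT (p u : Plane) :
    Filter.Tendsto (fun ε : ℝ => p + ε • u) (𝓝[>] 0) (𝓝 p) := by
  refine ((by fun_prop : Continuous fun ε : ℝ => p + ε • u).tendsto' 0 p ?_).mono_left
    nhdsWithin_le_nhds
  simp

lemma EncapsulatesPoint.exists_hasGerm (h : EncapsulatesPoint K p) (hK : ∀ i, Convex ℝ (K i))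
    (hu : u ≠ 0) : ∃ i, HasGerm (K i) p u := by
  have hne : ∀ᶠ ε : ℝ in 𝓝[>] 0, p + ε • u ∈ ({p} : Set Plane)ᶜ := by
    filter_upwards [self_mem_nhdsWithin] with ε hε
    simp [hu, (Set.mem_Ioi.1 hε).ne']
  have hmem := (tendsto_nhdsWithin_iff.2 ⟨tendsto_add_smul_nhdsGT p u, hne⟩).eventually
    h.eventually_mem_iUnion
  simp only [Set.mem_iUnion] at hmem
  obtain ⟨i, hi⟩ := Filter.frequently_exists.1 hmem.frequently
  exact ⟨i, hasGerm_of_frequently (hK i) hi⟩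

open Classical in
/-- The indices of the sets `K i` that contain a germ of some ray from `p`. -/
noncomputable def germColors (K : Fin k → Set Plane) (p : Plane) : Finset (Fin k) :=
  {i | ∃ u, HasGerm (K i) p u}

lemma mem_germColors {i : Fin k} : i ∈ germColors K p ↔ ∃ u, HasGerm (K i) p u := by
  simp [germColors]

lemma EncapsulatesPoint.two_le_card_germColors (h : EncapsulatesPoint K p)
    (hK : ∀ i, Convex ℝ (K i)) : 2 ≤ (germColors K p).card := by
  obtain ⟨u, hu⟩ : ∃ u : Plane, u ≠ 0 := exists_ne 0
  obtain ⟨i, hi⟩ := h.exists_hasGerm hK hu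
  obtain ⟨j, hj⟩ := h.exists_hasGerm hK (neg_ne_zero.2 hu)
  refine Finset.one_lt_card.2 ⟨i, mem_germColors.2 ⟨_, hi⟩, j, mem_germColors.2 ⟨_, hj⟩, ?_⟩
  rintro rfl
  exact h.notMem i (hi.mem_of_neg (hK i) hj)

lemma EncapsulatesPoint.three_le_card_germColors_union (hp : EncapsulatesPoint K p)
    (hq : EncapsulatesPoint K q) (hK : ∀ i, Convex ℝ (K i)) (hpq : p ≠ q) :
    3 ≤ (germColors K p ∪ germColors K q).card := by
  obtain ⟨a, ha⟩ := hp.exists_hasGerm hK (sub_ne_zero.2 hpq)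
  obtain ⟨b, hb⟩ := hq.exists_hasGerm hK (sub_ne_zero.2 hpq.symm)
  obtain ⟨c, hc⟩ := hp.exists_hasGerm hK (sub_ne_zero.2 hpq.symm)
  have hab : a ≠ b := by
    rintro rfl
    exact hp.notMem a (ha.mem_of_outward (hK a) hb)
  have hac : a ≠ c := by
    rintro rfl
    exact hp.notMem a (ha.mem_of_neg (hK a) (by rwa [neg_sub]))
  have hbc : b ≠ c := by
    rintro rfl
    exact hq.notMem b (hc.mem_of_parallel (hK b) hb)
  exact Finset.two_lt_card.2 ⟨a, Finset.mem_union_left _ (mem_germColors.2 ⟨_, ha⟩),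
    b, Finset.mem_union_right _ (mem_germColors.2 ⟨_, hb⟩),
    c, Finset.mem_union_left _ (mem_germColors.2 ⟨_, hc⟩), hab, hac, hbc⟩

end Colors

/-! ### Convex sets that meet in the hull -/

section MeetInHull

variable {P : Finset Plane} {K : Set Plane} {o p q r : Plane}

lemma ConvexPosition.mem_extremePoints_convexHull (hP : ConvexPosition P) (hq : q ∈ P) :
    q ∈ (convexHull ℝ (P : Set Plane)).extremePoints ℝ := by
  by_contra hcon
  have hsub : (convexHull ℝ (P : Set Plane)).extremePoints ℝ ⊆ (P : Set Plane) \ {q} := fun x hx =>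
    ⟨extremePoints_convexHull_subset hx, fun hxq => hcon (hxq ▸ hx)⟩
  refine hP.notMem_convexHull hq ?_
  rw [← ((P.finite_toSet.sdiff (t := {q})).isClosed_convexHull ℝ).closure_eq]
  refine closure_mono (convexHull_mono hsub) ?_
  rw [closure_convexHull_extremePoints (P.finite_toSet.isCompact_convexHull ℝ)
    (convex_convexHull ℝ _)]
  exact subset_convexHull ℝ _ hq

lemma ConvexPosition.convex_sdiff (hP : ConvexPosition P) (hq : q ∈ P) :
    Convex ℝ (convexHull ℝ (P : Set Plane) \ {q}) :=
  ((convex_convexHull ℝ _).mem_extremePoints_iff_convex_sdiff.1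
    (hP.mem_extremePoints_convexHull hq)).2

lemma nonneg_or_nonneg_of_notMem {E : Type*} [AddCommGroup E] [Module ℝ E] {C : Set E}
    {o p q r : E} (hC : Convex ℝ C) (ho : o ∈ C) (hp : p ∈ C) (hr : r ∈ C) (hq : q ∉ C)
    {α β γ : ℝ} (hsum : α + β + γ = 1) (h : o = α • p + β • q + γ • r) : 0 ≤ α ∨ 0 ≤ γ := by
  by_contra! hcon
  refine hq (mem_of_smul_eq_smul_add_smul_add_smul hC ho hp hr zero_le_one
    (neg_nonneg.2 hcon.1.le) (neg_nonneg.2 hcon.2.le) (by linarith) ?_)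
  obtain rfl : β = 1 - α - γ := by linarith
  rw [h]
  module

lemma ConvexPosition.nonneg_or_nonneg (hP : ConvexPosition P)
    (ho : o ∈ convexHull ℝ (P : Set Plane)) (hoP : o ∉ P) (hp : p ∈ P) (hq : q ∈ P) (hr : r ∈ P)
    (hpq : p ≠ q) (hqr : q ≠ r) {α β γ : ℝ} (hsum : α + β + γ = 1)
    (h : o = α • p + β • q + γ • r) : 0 ≤ α ∨ 0 ≤ γ := by
  have hsub := subset_convexHull ℝ (P : Set Plane)
  exact nonneg_or_nonneg_of_notMem (hP.convex_sdiff hq) ⟨ho, ne_of_mem_of_not_mem hq hoP |>.symm⟩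
    ⟨hsub hp, hpq⟩ ⟨hsub hr, hqr.symm⟩ (fun hq => hq.2 rfl) hsum h

lemma exists_barycentric (h : orient p q r ≠ 0) (o : Plane) :
    ∃ α β γ : ℝ, α + β + γ = 1 ∧ o = α • p + β • q + γ • r := by
  refine ⟨orient q r o / orient p q r, orient r p o / orient p q r, orient p q o / orient p q r,
    ?_, ?_⟩
  · rw [← add_div, ← add_div, orient_add_orient_add_orient, div_self h]
  · have ho := (eq_inv_smul_iff₀ h).2 (orient_smul_add_orient_smul_add_orient_smul p q r o).symm
    simpa only [smul_add, smul_smul, div_eq_inv_mul] using ho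

lemma ConvexPosition.mem_of_three_hasGerm (hP : ConvexPosition P) (hK : Convex ℝ K)
    (ho : o ∈ convexHull ℝ (P : Set Plane)) (hoP : o ∉ P) (hp : p ∈ P) (hq : q ∈ P) (hr : r ∈ P)
    (hpq : p ≠ q) (hpr : p ≠ r) (hqr : q ≠ r) (gp : HasGerm K p (p - o))
    (gq : HasGerm K q (q - o)) (gr : HasGerm K r (r - o)) : p ∈ K ∨ q ∈ K ∨ r ∈ K := by
  obtain ⟨α, β, γ, hsum, h⟩ :=
    exists_barycentric (hP.generalPosition.orient_ne_zero hp hq hr hpq hpr hqr) o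
  have hsum' : β + γ + α = 1 := by linarith
  have hsum'' : γ + α + β = 1 := by linarith
  have h' : o = β • q + γ • r + α • p := by rw [h]; abel
  have h'' : o = γ • r + α • p + β • q := by rw [h]; abel
  have hαγ := hP.nonneg_or_nonneg ho hoP hp hq hr hpq hqr hsum h
  have hβα := hP.nonneg_or_nonneg ho hoP hq hr hp hqr hpr.symm hsum' h'
  have hγβ := hP.nonneg_or_nonneg ho hoP hr hp hq hpr.symm hpq hsum'' h''
  rcases lt_or_ge α 0 with hα | hα
  · exact Or.inl (gr.mem_of_barycentric hK hsum'' h'' (hαγ.resolve_left hα.not_ge)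
      (hβα.resolve_right hα.not_ge) gp gq)
  rcases lt_or_ge γ 0 with hγ | hγ
  · exact Or.inr (Or.inr (gq.mem_of_barycentric hK hsum' h' (hγβ.resolve_left hγ.not_ge) hα gr gp))
  · exact Or.inr (Or.inl (gp.mem_of_barycentric hK hsum h hα hγ gq gr))

lemma ConvexPosition.card_filter_le_two (hP : ConvexPosition P) (hK : Convex ℝ K)
    (hPK : ∀ p ∈ P, p ∉ K) (ho : o ∈ convexHull ℝ (P : Set Plane)) (hoP : o ∉ P)
    {S : Finset Plane} (hS : ∀ p ∈ S, p ∈ P ∧ HasGerm K p (p - o)) : S.card ≤ 2 := by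
  by_contra! hlt
  obtain ⟨p, hp, q, hq, r, hr, hpq, hpr, hqr⟩ := Finset.two_lt_card.1 hlt
  rcases hP.mem_of_three_hasGerm hK ho hoP (hS p hp).1 (hS q hq).1 (hS r hr).1 hpq hpr hqr
    (hS p hp).2 (hS q hq).2 (hS r hr).2 with h | h | h
  exacts [hPK p (hS p hp).1 h, hPK q (hS q hq).1 h, hPK r (hS r hr).1 h]

/-- The sets that leave `P` in the directions away from `o` are different from the two sets
containing `o`, and each of them leaves at most two points of `P`. -/
lemma ConvexPosition.card_add_four_le (hP : ConvexPosition P) {k : ℕ} {K : Fin k → Set Plane}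
    (hK : ∀ i, Convex ℝ (K i)) (hE : Encapsulates K P) {a b : Fin k} (hab : a ≠ b)
    (hoa : o ∈ K a) (hob : o ∈ K b) (ho : o ∈ convexHull ℝ (P : Set Plane)) :
    P.card + 4 ≤ 2 * k := by
  classical
  have hPK (i : Fin k) : ∀ p ∈ P, p ∉ K i := fun p hp => (hE p hp).notMem i
  have hoP : o ∉ P := fun h => hPK a o h hoa
  have hex : ∀ p ∈ P, ∃ i, HasGerm (K i) p (p - o) := fun p hp =>
    (hE p hp).exists_hasGerm hK (sub_ne_zero.2 (ne_of_mem_of_not_mem hp hoP))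
  have : Nonempty (Fin k) := ⟨a⟩
  choose! i hi using hex
  have hmaps : ∀ p ∈ P, i p ∈ ({a, b} : Finset (Fin k))ᶜ := fun p hp => by
    simp only [Finset.mem_compl, Finset.mem_insert, Finset.mem_singleton, not_or]
    constructor <;> intro h
    · exact hPK a p hp ((h ▸ hi p hp).mem_of_mem (hK a) hoa)
    · exact hPK b p hp ((h ▸ hi p hp).mem_of_mem (hK b) hob)
  have hle := Finset.card_le_mul_card_image_of_maps_to hmaps 2 fun c _ =>
    hP.card_filter_le_two (hK c) (hPK c) ho hoP fun p hp => by
      obtain ⟨hpP, rfl⟩ := Finset.mem_filter.1 hp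
      exact ⟨hpP, hi p hpP⟩
  have hcompl := Finset.card_add_card_compl ({a, b} : Finset (Fin k))
  rw [Finset.card_pair hab, Fintype.card_fin] at hcompl
  omega

end MeetInHull

/-! ### The lower bounds for convex position -/

section ConvexQuad

variable {a b c d : Plane}

/-- The points `a`, `b`, `c`, `d` are, in counterclockwise order, the vertices of a convex
quadrilateral. -/
def ConvexQuad (a b c d : Plane) : Prop :=
  0 < orient a b c ∧ 0 < orient b c d ∧ 0 < orient c d a ∧ 0 < orient d a b

/-- The point where the lines `a c` and `b d` cross, a junk value if they are parallel. -/
noncomputable def crossing (a b c d : Plane) : Plane :=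
  lineMap a c (orient d a b / (orient b c d + orient d a b))

namespace ConvexQuad

lemma rotate (h : ConvexQuad a b c d) : ConvexQuad b c d a :=
  ⟨h.2.1, h.2.2.1, h.2.2.2, h.1⟩

lemma orient_add_orient_pos (h : ConvexQuad a b c d) : 0 < orient b c d + orient d a b :=
  add_pos h.2.1 h.2.2.2

lemma crossing_rotate (h : ConvexQuad a b c d) : crossing b c d a = crossing a b c d := by
  have hne := h.orient_add_orient_pos.ne'
  have hden : orient c d a + orient a b c = orient b c d + orient d a b := by
    simp only [orient_apply]
    ring
  rw [crossing, crossing, hden]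
  generalize hw : orient b c d + orient d a b = w at *
  ext i
  fin_cases i <;> simp only [AffineMap.lineMap_apply, vsub_eq_sub, vadd_eq_add, Fin.zero_eta,
    Fin.mk_one, PiLp.add_apply, PiLp.smul_apply, PiLp.sub_apply, smul_eq_mul] <;> field_simp <;>
    rw [← hw] <;> simp only [orient_apply] <;> ring

lemma crossing_mem_segment (h : ConvexQuad a b c d) : crossing a b c d ∈ segment ℝ a c := by
  rw [segment_eq_image_lineMap]
  have hpos := h.orient_add_orient_pos
  exact ⟨_, ⟨div_nonneg h.2.2.2.le hpos.le,
    (div_le_one hpos).2 (le_add_of_nonneg_left h.2.1.le)⟩, rfl⟩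

lemma orient_crossing_pos (h : ConvexQuad a b c d) : 0 < orient a b (crossing a b c d) := by
  rw [crossing, AffineMap.apply_lineMap, orient_self_left, lineMap_apply_ring']
  simpa using mul_pos (div_pos h.2.2.2 h.orient_add_orient_pos) h.1

lemma mem_convexHull (h : ConvexQuad a b c d) {z : Plane} (hab : 0 ≤ orient a b z)
    (hbc : 0 ≤ orient b c z) (hcd : 0 ≤ orient c d z) (hda : 0 ≤ orient d a z) :
    z ∈ convexHull ℝ {a, b, c, d} := by
  rcases le_total 0 (orient c a z) with hca | hca
  · exact mem_convexHull_of_orient_nonneg (by simp) (by simp) (by simp) h.1 hbc hca hab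
  · rw [orient_swap, neg_nonpos] at hca
    exact mem_convexHull_of_orient_nonneg (by simp) (by simp) (by simp) h.2.2.1 hda hca hcd

section Tendsto

variable {ι : Type*} {l : Filter ι} {A B C D : ι → Plane}

lemma tendsto_orient (hA : Filter.Tendsto A l (𝓝 a)) (hB : Filter.Tendsto B l (𝓝 b))
    (hC : Filter.Tendsto C l (𝓝 c)) :
    Filter.Tendsto (fun i => orient (A i) (B i) (C i)) l (𝓝 (orient a b c)) := by
  have hcoord {X : ι → Plane} {x : Plane} (hX : Filter.Tendsto X l (𝓝 x)) (j : Fin 2) :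
      Filter.Tendsto (fun i => X i j) l (𝓝 (x j)) :=
    ((PiLp.continuous_apply 2 _ j).tendsto x).comp hX
  simp only [orient_apply]
  exact (((hcoord hB 0).sub (hcoord hA 0)).mul ((hcoord hC 1).sub (hcoord hA 1))).sub
    (((hcoord hB 1).sub (hcoord hA 1)).mul ((hcoord hC 0).sub (hcoord hA 0)))

lemma eventually_convexQuad (h : ConvexQuad a b c d) (hA : Filter.Tendsto A l (𝓝 a))
    (hB : Filter.Tendsto B l (𝓝 b)) (hC : Filter.Tendsto C l (𝓝 c))
    (hD : Filter.Tendsto D l (𝓝 d)) : ∀ᶠ i in l, ConvexQuad (A i) (B i) (C i) (D i) := by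
  filter_upwards [(tendsto_orient hA hB hC).eventually (lt_mem_nhds h.1),
    (tendsto_orient hB hC hD).eventually (lt_mem_nhds h.2.1),
    (tendsto_orient hC hD hA).eventually (lt_mem_nhds h.2.2.1),
    (tendsto_orient hD hA hB).eventually (lt_mem_nhds h.2.2.2)] with i h₁ h₂ h₃ h₄
  exact ⟨h₁, h₂, h₃, h₄⟩

lemma tendsto_crossing (h : ConvexQuad a b c d) (hA : Filter.Tendsto A l (𝓝 a))
    (hB : Filter.Tendsto B l (𝓝 b)) (hC : Filter.Tendsto C l (𝓝 c))
    (hD : Filter.Tendsto D l (𝓝 d)) :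
    Filter.Tendsto (fun i => crossing (A i) (B i) (C i) (D i)) l (𝓝 (crossing a b c d)) :=
  hA.lineMap hC ((tendsto_orient hD hA hB).div
    ((tendsto_orient hB hC hD).add (tendsto_orient hD hA hB)) h.orient_add_orient_pos.ne')

lemma eventually_crossing_mem_convexHull (h : ConvexQuad a b c d)
    (hA : Filter.Tendsto A l (𝓝 a)) (hB : Filter.Tendsto B l (𝓝 b))
    (hC : Filter.Tendsto C l (𝓝 c)) (hD : Filter.Tendsto D l (𝓝 d)) :
    ∀ᶠ i in l, crossing (A i) (B i) (C i) (D i) ∈ convexHull ℝ {a, b, c, d} := by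
  have hX := h.tendsto_crossing hA hB hC hD
  have hpos {x y : Plane} (hxy : 0 < orient x y (crossing a b c d)) :
      ∀ᶠ i in l, 0 < orient x y (crossing (A i) (B i) (C i) (D i)) :=
    (tendsto_orient tendsto_const_nhds tendsto_const_nhds hX).eventually (lt_mem_nhds hxy)
  have hbc := h.crossing_rotate ▸ h.rotate.orient_crossing_pos
  have hcd := h.crossing_rotate ▸ h.rotate.crossing_rotate ▸ h.rotate.rotate.orient_crossing_pos
  have hda := h.rotate.rotate.rotate.crossing_rotate ▸ h.rotate.rotate.rotate.orient_crossing_pos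
  filter_upwards [hpos h.orient_crossing_pos, hpos hbc, hpos hcd, hpos hda] with i hab hbc hcd hda
  exact h.mem_convexHull hab.le hbc.le hcd.le hda.le

end Tendsto

lemma exists_mem_convexHull_of_hasGerm (h : ConvexQuad a b c d) {K L : Set Plane}
    (hK : Convex ℝ K) (hL : Convex ℝ L) {u v w z : Plane} (ha : HasGerm K a u)
    (hc : HasGerm K c v) (hb : HasGerm L b w) (hd : HasGerm L d z) :
    ∃ x ∈ convexHull ℝ {a, b, c, d}, x ∈ K ∧ x ∈ L := by
  have hA := tendsto_add_smul_nhdsGT a u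
  have hB := tendsto_add_smul_nhdsGT b w
  have hC := tendsto_add_smul_nhdsGT c v
  have hD := tendsto_add_smul_nhdsGT d z
  obtain ⟨ε, ⟨⟨⟨ha, hb⟩, hc, hd⟩, hquad⟩, hhull⟩ := ((((ha.and hb).and (hc.and hd)).and
    (h.eventually_convexQuad hA hB hC hD)).and
      (h.eventually_crossing_mem_convexHull hA hB hC hD)).exists
  refine ⟨_, hhull, hK.segment_subset ha hc hquad.crossing_mem_segment,
    hL.segment_subset hb hd ?_⟩
  rw [← hquad.crossing_rotate]
  exact hquad.rotate.crossing_mem_segment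

end ConvexQuad

end ConvexQuad

section LowerBound

variable {P : Finset Plane} {k : ℕ} {K : Fin k → Set Plane}

lemma nonCrossing_germColors {f : ℕ → Plane} (hf : Set.BijOn f (Set.Iio P.card) P)
    (hpos : ∀ i j l, i < j → j < l → l < P.card → 0 < orient (f i) (f j) (f l))
    (hK : ∀ i, Convex ℝ (K i)) (hE : Encapsulates K P)
    (hdisj : ∀ i j, i ≠ j → ∀ z ∈ convexHull ℝ (P : Set Plane), z ∈ K i → z ∉ K j) :
    NonCrossing (Finset.range P.card) fun i => germColors K (f i) where
  eq_of_lt {a b c d i j} ha hb hc hd hab hbc hcd hia hic hjb hjd := by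
    rw [Finset.mem_range] at ha hb hc hd
    obtain ⟨⟨_, hia⟩, _, hic⟩ := And.intro (mem_germColors.1 hia) (mem_germColors.1 hic)
    obtain ⟨⟨_, hjb⟩, _, hjd⟩ := And.intro (mem_germColors.1 hjb) (mem_germColors.1 hjd)
    have hquad : ConvexQuad (f a) (f b) (f c) (f d) := by
      refine ⟨hpos a b c hab hbc hc, hpos b c d hbc hcd hd, ?_, ?_⟩
      · rw [orient_rotate]
        exact hpos a c d (hab.trans hbc) hcd hd
      · rw [← orient_rotate]
        exact hpos a b d hab (hbc.trans hcd) hd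
    obtain ⟨z, hz, hzi, hzj⟩ :=
      hquad.exists_mem_convexHull_of_hasGerm (hK i) (hK j) hia hic hjb hjd
    have hsub : {f a, f b, f c, f d} ⊆ (P : Set Plane) := by
      simp [Set.insert_subset_iff, hf.mapsTo ha, hf.mapsTo hb, hf.mapsTo hc, hf.mapsTo hd]
    by_contra hij
    exact hdisj i j hij z (convexHull_mono hsub hz) hzi hzj
  two_le_card hp := (hE _ (hf.mapsTo (Finset.mem_range.1 hp))).two_le_card_germColors hK
  three_le_card {p q} hp hq hpq := by
    rw [Finset.mem_range] at hp hq
    exact (hE _ (hf.mapsTo hp)).three_le_card_germColors_union (hE _ (hf.mapsTo hq)) hK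
      (hf.injOn.ne hp hq hpq)

lemma ConvexPosition.two_mul_card_add_three_le (hP : ConvexPosition P)
    (hK : ∀ i, Convex ℝ (K i)) (hE : Encapsulates K P) (hne : P.Nonempty)
    (hdisj : ∀ i j, i ≠ j → ∀ z ∈ convexHull ℝ (P : Set Plane), z ∈ K i → z ∉ K j) :
    2 * P.card + 3 ≤ 3 * k := by
  obtain ⟨f, hf, hpos⟩ := hP.exists_bijOn_orient_pos
  have hle := (nonCrossing_germColors hf hpos hK hE hdisj).two_mul_card_add_three_le
    (Finset.nonempty_range_iff.2 hne.card_ne_zero)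
  have hk := card_finset_fin_le ((Finset.range P.card).biUnion fun i => germColors K (f i))
  rw [Finset.card_range] at hle
  omega

theorem ConvexPosition.disjointBound_le (hP : ConvexPosition P) (hK : ∀ i, Convex ℝ (K i))
    (hE : Encapsulates K P) (hne : P.Nonempty)
    (hdisj : Pairwise fun i j => Disjoint (K i) (K j)) : disjointBound P.card ≤ k := by
  have := hP.two_mul_card_add_three_le hK hE hne
    fun i j hij z _ hz => Set.disjoint_left.1 (hdisj hij) hz
  unfold disjointBound
  omega

theorem ConvexPosition.convexBound_le (hP : ConvexPosition P) (hK : ∀ i, Convex ℝ (K i))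
    (hE : Encapsulates K P) (hne : P.Nonempty) : convexBound P.card ≤ k := by
  have hpos := hne.card_pos
  have hcases : P.card + 4 ≤ 2 * k ∨ 2 * P.card + 3 ≤ 3 * k := by
    by_cases hdisj : ∀ i j, i ≠ j → ∀ z ∈ convexHull ℝ (P : Set Plane), z ∈ K i → z ∉ K j
    · exact Or.inr (hP.two_mul_card_add_three_le hK hE hne hdisj)
    · push Not at hdisj
      obtain ⟨i, j, hij, z, hz, hzi, hzj⟩ := hdisj
      exact Or.inl (hP.card_add_four_le hK hE hij hzi hzj hz)
  unfold convexBound delta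
  split_ifs <;> omega

end LowerBound

/-! ### The covering and encapsulation numbers -/

section CoveringNumbers

variable {P : Finset Plane} {k : ℕ} {K : Fin k → Set Plane}

lemma IsConvexUnion.cov_le (h : IsConvexUnion False (P : Set Plane)ᶜ k) : cov P ≤ k := by
  obtain ⟨K, hK, -, hU⟩ := h
  exact iInf₂_le k ⟨K, hK, hU⟩

lemma IsConvexUnion.covDisj_le (h : IsConvexUnion True (P : Set Plane)ᶜ k) : covDisj P ≤ k := by
  obtain ⟨K, hK, hdisj, hU⟩ := h
  exact iInf₂_le k ⟨K, hK, hdisj trivial, hU⟩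

lemma CoversCompl.encapsulates (h : CoversCompl K P) : Encapsulates K P := by
  refine fun p hp => ⟨((P : Set Plane) \ {p})ᶜ, ?_, ?_⟩
  · exact P.finite_toSet.sdiff.isClosed.isOpen_compl.mem_nhds (by simp)
  · rw [show ⋃ i, K i = (P : Set Plane)ᶜ from h]
    ext z
    by_cases hz : z = p <;> simp [hz, hp]

lemma CoversCompl.pos (h : CoversCompl K P) : 1 ≤ k := by
  obtain ⟨z, hz⟩ := P.finite_toSet.infinite_compl.nonempty
  rw [← show ⋃ i, K i = (P : Set Plane)ᶜ from h] at hz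
  obtain ⟨i, -⟩ := Set.mem_iUnion.1 hz
  exact i.pos

variable (P) in
lemma enc_le_cov : enc P ≤ cov P :=
  le_iInf₂ fun k ⟨K, hK, h⟩ => iInf₂_le k ⟨K, hK, h.encapsulates⟩

variable (P) in
lemma encDisj_le_covDisj : encDisj P ≤ covDisj P :=
  le_iInf₂ fun k ⟨K, hK, hdisj, h⟩ => iInf₂_le k ⟨K, hK, hdisj, h.encapsulates⟩

namespace GeneralPosition

lemma cov_le (hP : GeneralPosition P) : cov P ≤ ((7 * P.card + 44) / 11 : ℕ) :=
  hP.isConvexUnion_sevenElevenths.cov_le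

lemma covDisj_le (hP : GeneralPosition P) : covDisj P ≤ disjointBound P.card :=
  (hP.isConvexUnion_disjointBound True).covDisj_le

end GeneralPosition

namespace ConvexPosition

lemma convexBound_le_enc (hP : ConvexPosition P) (hne : P.Nonempty) :
    convexBound P.card ≤ enc P :=
  le_iInf₂ fun _ ⟨_, hK, h⟩ => Nat.cast_le.2 (hP.convexBound_le hK h hne)

lemma disjointBound_le_encDisj (hP : ConvexPosition P) (hne : P.Nonempty) :
    disjointBound P.card ≤ encDisj P :=
  le_iInf₂ fun _ ⟨_, hK, hdisj, h⟩ => Nat.cast_le.2 (hP.disjointBound_le hK h hne hdisj)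

lemma cov_eq (hP : ConvexPosition P) : cov P = convexBound P.card := by
  refine hP.isConvexUnion_convexBound.cov_le.antisymm ?_
  rcases P.eq_empty_or_nonempty with rfl | hne
  · exact le_iInf₂ fun _ ⟨_, _, h⟩ => Nat.cast_le.2 h.pos
  · exact (hP.convexBound_le_enc hne).trans (enc_le_cov P)

lemma covDisj_eq (hP : ConvexPosition P) : covDisj P = disjointBound P.card := by
  refine hP.generalPosition.covDisj_le.antisymm ?_
  rcases P.eq_empty_or_nonempty with rfl | hne
  · exact le_iInf₂ fun _ ⟨_, _, _, h⟩ => Nat.cast_le.2 h.pos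
  · exact (hP.disjointBound_le_encDisj hne).trans (encDisj_le_covDisj P)

lemma enc_eq (hP : ConvexPosition P) (hne : P.Nonempty) : enc P = convexBound P.card :=
  ((enc_le_cov P).trans hP.cov_eq.le).antisymm (hP.convexBound_le_enc hne)

lemma encDisj_eq (hP : ConvexPosition P) (hne : P.Nonempty) :
    encDisj P = disjointBound P.card :=
  ((encDisj_le_covDisj P).trans hP.covDisj_eq.le).antisymm (hP.disjointBound_le_encDisj hne)

end ConvexPosition

end CoveringNumbers

lemma exists_convexPosition (n : ℕ) : ∃ P : Finset Plane, ConvexPosition P ∧ P.card = n := by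
  classical
  let g : ℝ → Plane := fun x => !₂[x, x ^ 2]
  have hg : Function.Injective fun i : ℕ => g i := fun i j h => by
    simpa [g] using congrArg (fun z : Plane => z 0) h
  refine ⟨(Finset.range n).image fun i : ℕ => g i, ?_, by
    rw [Finset.card_image_of_injective _ hg, Finset.card_range]⟩
  refine convexIndependent_set_iff_notMem_convexHull_sdiff.2 fun x hx hmem => ?_
  obtain ⟨i, -, rfl⟩ := Finset.mem_image.1 hx
  -- The tangent to the parabola at `g i` separates this point from the other ones.
  let tangent := orient (g i) !₂[(i : ℝ) + 1, i ^ 2 + 2 * i]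
  have htangent (j : ℕ) : 0 < tangent (g j) ↔ j ≠ i := by
    have : tangent (g j) = ((j : ℝ) - i) ^ 2 := by
      simp only [tangent, g, orient_apply, Matrix.cons_val_zero, Matrix.cons_val_one]
      ring
    rw [this, sq_pos_iff, sub_ne_zero, Nat.cast_injective.ne_iff]
  refine (htangent i).1 (convexHull_min (t := tangent ⁻¹' Set.Ioi 0) ?_
    ((convex_Ioi 0).affine_preimage tangent) hmem) rfl
  rintro z ⟨hz, hzi⟩
  obtain ⟨j, -, rfl⟩ := Finset.mem_image.1 hz
  exact (htangent j).2 fun hji => hzi (hji ▸ rfl)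

section Maxima

variable {f : Finset Plane → ℕ∞} {n : ℕ} {b : ℕ∞}

lemma maxGeneral_le (h : ∀ P, GeneralPosition P → P.card = n → f P ≤ b) : maxGeneral f n ≤ b :=
  iSup₂_le fun P hP => h P hP.1 hP.2

lemma le_maxGeneral (h : ∀ P, ConvexPosition P → P.card = n → b ≤ f P) : b ≤ maxGeneral f n := by
  obtain ⟨P, hP, hcard⟩ := exists_convexPosition n
  exact le_iSup₂_of_le P ⟨hP.generalPosition, hcard⟩ (h P hP hcard)

lemma maxConvex_eq (h : ∀ P, ConvexPosition P → P.card = n → f P = b) : maxConvex f n = b := by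
  obtain ⟨P, hP, hcard⟩ := exists_convexPosition n
  exact le_antisymm (iSup₂_le fun Q hQ => (h Q hQ.1 hQ.2).le)
    (le_iSup₂_of_le P ⟨hP, hcard⟩ (h P hP hcard).ge)

end Maxima

lemma toENNReal_le_of_le_div {m : ℕ∞} {n : ℕ} (h : m ≤ ((7 * n + 44) / 11 : ℕ)) :
    (m : ℝ≥0∞) ≤ 7 * (n : ℝ≥0∞) / 11 + 4 := by
  have hfour : (4 : ℝ≥0∞) = 44 / 11 := by
    rw [ENNReal.eq_div_iff (by norm_num) (by norm_num)]
    norm_num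
  refine (ENat.toENNReal_le.2 h).trans ?_
  rw [ENat.toENNReal_coe, hfour, ← ENNReal.add_div, ENNReal.le_div_iff_mul_le (by simp) (by simp)]
  exact_mod_cast Nat.div_mul_le_self (7 * n + 44) 11

theorem theorem1 (n : ℕ) :
    -- points in convex position
    (∀ P : Finset Plane, ConvexPosition P → P.card = n →
      (cov P = convexBound n ∧ covDisj P = disjointBound n) ∧
      (1 ≤ n → enc P = convexBound n ∧ encDisj P = disjointBound n)) ∧
    (maxConvex cov n = convexBound n ∧ maxConvex covDisj n = disjointBound n) ∧
    (1 ≤ n → maxConvex enc n = convexBound n ∧ maxConvex encDisj n = disjointBound n) ∧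
    -- points in general position
    (∀ P : Finset Plane, GeneralPosition P → P.card = n →
      (enc P : ℝ≥0∞) ≤ 7 * (n : ℝ≥0∞) / 11 + 4 ∧
      (cov P : ℝ≥0∞) ≤ 7 * (n : ℝ≥0∞) / 11 + 4 ∧
      encDisj P ≤ disjointBound n ∧
      covDisj P ≤ disjointBound n) ∧
    ((maxGeneral enc n : ℝ≥0∞) ≤ 7 * (n : ℝ≥0∞) / 11 + 4 ∧
      (maxGeneral cov n : ℝ≥0∞) ≤ 7 * (n : ℝ≥0∞) / 11 + 4) ∧
    (convexBound n ≤ maxGeneral cov n ∧ maxGeneral covDisj n = disjointBound n) ∧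
    (1 ≤ n → convexBound n ≤ maxGeneral enc n ∧ maxGeneral encDisj n = disjointBound n) := by
  have hconv (P : Finset Plane) (hP : ConvexPosition P) (hn : P.card = n) :
      (cov P = convexBound n ∧ covDisj P = disjointBound n) ∧
      (1 ≤ n → enc P = convexBound n ∧ encDisj P = disjointBound n) := by
    subst hn
    exact ⟨⟨hP.cov_eq, hP.covDisj_eq⟩, fun hn =>
      ⟨hP.enc_eq (Finset.card_pos.1 hn), hP.encDisj_eq (Finset.card_pos.1 hn)⟩⟩
  have hcov (P : Finset Plane) (hP : GeneralPosition P) (hn : P.card = n) :=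
    hn ▸ hP.cov_le
  have hcovDisj (P : Finset Plane) (hP : GeneralPosition P) (hn : P.card = n) :=
    hn ▸ hP.covDisj_le
  have henc P hP hn := (enc_le_cov P).trans (hcov P hP hn)
  have hencDisj P hP hn := (encDisj_le_covDisj P).trans (hcovDisj P hP hn)
  exact ⟨hconv,
    ⟨maxConvex_eq fun P hP hn => (hconv P hP hn).1.1,
      maxConvex_eq fun P hP hn => (hconv P hP hn).1.2⟩,
    fun hpos => ⟨maxConvex_eq fun P hP hn => ((hconv P hP hn).2 hpos).1,
      maxConvex_eq fun P hP hn => ((hconv P hP hn).2 hpos).2⟩,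
    fun P hP hn => ⟨toENNReal_le_of_le_div (henc P hP hn),
      toENNReal_le_of_le_div (hcov P hP hn), hencDisj P hP hn, hcovDisj P hP hn⟩,
    ⟨toENNReal_le_of_le_div (maxGeneral_le henc), toENNReal_le_of_le_div (maxGeneral_le hcov)⟩,
    ⟨le_maxGeneral fun P hP hn => (hconv P hP hn).1.1.ge,
      (maxGeneral_le hcovDisj).antisymm
        (le_maxGeneral fun P hP hn => (hconv P hP hn).1.2.ge)⟩,
    fun hpos => ⟨le_maxGeneral fun P hP hn => ((hconv P hP hn).2 hpos).1.ge,
      (maxGeneral_le hencDisj).antisymm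
        (le_maxGeneral fun P hP hn => ((hconv P hP hn).2 hpos).2.ge)⟩⟩
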